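/- Let $V>0$, $\alpha=\frac{\sqrt5-1}{2}$, and for $\omega\in\mathbb T=\mathbb R/\mathbb Z$ let $H_{V,\omega}$ be the Fibonacci Hamiltonian on $\ell^2(\mathbb Z)$, $$[H_{V,\omega}\psi](n)=\psi(n+1)+\psi(n-1)+V\chi_{[1-\alpha,1)}(n\alpha+\omega \bmod 1)\,\psi(n).$$ Its spectrum does not depend on $\omega$ and is denoted by $\Sigma_V$. Let $a_V$ be the largest root of the polynomial $x^3-(2+V)x-1$. For $u:\mathbb Z\to\mathbb C$ and $L\ge 1$ define the local $\ell^2$ norm by $$\|u\|_L^2=\sum_{n=1}^{[L]}|u(n)|^2+(L-[L])\,|u([L]+1)|^2 ,$$ where $[L]$ is the integer part of $L$. Then, for all real numbers $$\gamma_\ell<\frac{\log\left(1+\frac1{(2+2V)^2}\right)}{16\log\left(\frac{\sqrt5+1}{2}\right)}\quad\text{and}\quad \gamma_u>1+\frac{\log\left[(5+2V)^{1/2}(3+V)\,a_V\right]}{\log\frac{\sqrt5+1}{2}},$$ the following holds. (i) There is a constant $C_u>0$ such that for every $\omega\in\mathbb T$, every $E\in\Sigma_V$, every $L\ge1$, and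 every solution $u$ of the difference equation $H_{V,\omega}u=Eu$ normalized by $|u(0)|^2+|u(1)|^2=1$, we have $\|u\|_L\le C_u L^{\gamma_u}$. (ii) For every $L_0>1$ there is a constant $C_\ell>0$ such that for every $\omega\in\mathbb T$, every $E\in\Sigma_V$, every $L\ge L_0$, and every solution $u$ of $H_{V,\omega}u=Eu$ normalized by $|u(0)|^2+|u(1)|^2=1$, we have $C_\ell L^{\gamma_\ell}\le\|u\|_L$. -/

import Mathlib

open scoped ENNReal

noncomputable section

namespace FibHam

/-- The rotation number `α = (√5 - 1) / 2`. -/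
def alpha : ℝ := (Real.sqrt 5 - 1) / 2

/-- The golden mean `(√5 + 1) / 2`. -/
def phi : ℝ := (Real.sqrt 5 + 1) / 2

open Classical in
/-- The Fibonacci potential `V χ_{[1-α,1)}(nα + ω mod 1)`. The phase `ω ∈ 𝕋 = ℝ/ℤ` is given by a
real representative, and `Int.fract` is reduction mod 1. -/
def potential (V ω : ℝ) (n : ℤ) : ℝ :=
  if Int.fract (n * alpha + ω) ∈ Set.Ico (1 - alpha) 1 then V else 0

/-- The difference expression `u(n+1) + u(n-1) + V χ_{[1-α,1)}(nα + ω mod 1) u(n)`, on arbitrary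
two-sided sequences. -/
def diffExpr (V ω : ℝ) (u : ℤ → ℂ) (n : ℤ) : ℂ :=
  u (n + 1) + u (n - 1) + (potential V ω n : ℂ) * u n

/-- The Hilbert space `ℓ²(ℤ)`. -/
abbrev ellTwo : Type := lp (fun _ : ℤ => ℂ) 2

theorem norm_potential_le (V ω : ℝ) (n : ℤ) : ‖(potential V ω n : ℂ)‖ ≤ |V| := by
  unfold potential
  split_ifs <;> simp

theorem memlp_comp (e : ℤ ≃ ℤ) (f : ℤ → ℂ) (hf : Memℓp f 2) : Memℓp (fun n => f (e n)) 2 := by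
  have h2 : 0 < (2 : ℝ≥0∞).toReal := by norm_num
  have := (memℓp_gen_iff h2).1 hf
  exact (memℓp_gen_iff h2).2 (e.summable_iff.2 this)

/-- The unitary operator on `ℓ²(ℤ)` given by composition with a permutation of `ℤ`. -/
def permOp (e : ℤ ≃ ℤ) : ellTwo →L[ℂ] ellTwo :=
  LinearMap.mkContinuous
    { toFun := fun f => ⟨fun n => f (e n), memlp_comp e f (lp.memℓp f)⟩
      map_add' := fun _ _ => rfl
      map_smul' := fun _ _ => rfl } 1 (by
    intro f
    have h2 : 0 < (2 : ℝ≥0∞).toReal := by norm_num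
    refine lp.norm_le_of_tsum_le h2 (by positivity) ?_
    rw [one_mul, lp.norm_rpow_eq_tsum h2 f]
    exact le_of_eq (e.tsum_eq (fun n => ‖f n‖ ^ (2 : ℝ≥0∞).toReal)))

/-- Multiplication by the Fibonacci potential on `ℓ²(ℤ)`. -/
def potOp (V ω : ℝ) : ellTwo →L[ℂ] ellTwo :=
  lp.mapCLM 2 (fun n : ℤ => (potential V ω n : ℂ) • ContinuousLinearMap.id ℂ ℂ)
    (K := |V|) (abs_nonneg V) (fun n => by
      rw [norm_smul, ContinuousLinearMap.norm_id, mul_one]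
      exact norm_potential_le V ω n)

/-- The Fibonacci Hamiltonian `H_{V,ω}` as a bounded operator on `ℓ²(ℤ)`. -/
def hamiltonian (V ω : ℝ) : ellTwo →L[ℂ] ellTwo :=
  permOp (Equiv.addRight 1) + permOp (Equiv.subRight 1) + potOp V ω

/-- The Hamiltonian acts by the difference expression. -/
theorem hamiltonian_apply (V ω : ℝ) (f : ellTwo) (n : ℤ) :
    (hamiltonian V ω f) n = diffExpr V ω f n := by
  rfl

/-- The spectrum `Σ_V` of the family. The spectrum `σ(H_{V,ω})` is the same set for all `ω`;
in order not to single out a phase, `Σ_V` is taken as the set of all `E` that lie in `σ(H_{V,ω})`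
for some `ω`. -/
def Sigma (V : ℝ) : Set ℝ :=
  {E : ℝ | ∃ ω : ℝ, (E : ℂ) ∈ spectrum ℂ (hamiltonian V ω)}

/-- `u : ℤ → ℂ`, not necessarily square summable, solves `H_{V,ω} u = E u`. -/
def IsSolution (V ω E : ℝ) (u : ℤ → ℂ) : Prop :=
  ∀ n : ℤ, diffExpr V ω u n = (E : ℂ) * u n

/-- The local `ℓ²` norm: `‖u‖_L² = ∑_{n=1}^{[L]} |u(n)|² + (L - [L]) |u([L]+1)|²`. -/
def localNorm (u : ℤ → ℂ) (L : ℝ) : ℝ :=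
  Real.sqrt (∑ n ∈ Finset.Icc (1 : ℤ) ⌊L⌋, ‖u n‖ ^ 2 + (L - ⌊L⌋) * ‖u (⌊L⌋ + 1)‖ ^ 2)

/-- `a_V`, the largest real root of `x³ - (2 + V) x - 1`. -/
def largestRoot (V : ℝ) : ℝ := sSup {x : ℝ | x ^ 3 - (2 + V) * x - 1 = 0}

/-- For `V > 0` the supremum in the definition of `a_V` is attained and is a genuine maximum. -/
theorem isGreatest_largestRoot (V : ℝ) (hV : 0 < V) :
    IsGreatest {x : ℝ | x ^ 3 - (2 + V) * x - 1 = 0} (largestRoot V) := by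
  have hclosed : IsClosed {x : ℝ | x ^ 3 - (2 + V) * x - 1 = 0} :=
    isClosed_eq (by fun_prop) continuous_const
  have hne : {x : ℝ | x ^ 3 - (2 + V) * x - 1 = 0}.Nonempty := by
    have hc : ContinuousOn (fun x : ℝ => x ^ 3 - (2 + V) * x - 1) (Set.Icc 0 (3 + V)) := by
      fun_prop
    have h := intermediate_value_Icc (by linarith : (0 : ℝ) ≤ 3 + V) hc
    obtain ⟨x, -, hx⟩ := h (show (0 : ℝ) ∈ _ from ⟨by norm_num, by
      nlinarith [sq_nonneg V, mul_pos hV hV, mul_pos (mul_pos hV hV) hV]⟩)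
    exact ⟨x, hx⟩
  have hbdd : BddAbove {x : ℝ | x ^ 3 - (2 + V) * x - 1 = 0} := by
    refine ⟨3 + V, fun x hx => ?_⟩
    by_contra hlt
    push Not at hlt
    have hx' : x ^ 3 - (2 + V) * x - 1 = 0 := hx
    have h1 : 0 < x := by linarith
    have h2 : (3 + V) * x < x * x := by nlinarith
    nlinarith [mul_lt_mul_of_pos_right h2 h1]
  exact ⟨hclosed.csSup_mem hne hbdd, fun x hx => le_csSup hbdd hx⟩

end FibHam

end

namespace FibHam

/-! ### The golden rotation -/

/-! Both bounds come from the repetitions of the Fibonacci potential at the scales `fib k`, together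
with a bound on the traces `x_k` of the transfer matrices over windows of length `fib k`. The
potential is `V` times the increment of `rot ω n = ⌊nα + ω⌋`, and it fails to repeat after `fib k`
sites only next to crossings.

Traces: the numbers `x_k` obey the trace map and do not depend on phase or position, apart from
windows starting at a crossing. If `E` is in the spectrum, a truncated approximate eigenfunction
placed on a circle of length `fib k` yields an eigenvalue `E'` near `E` with `x_k(E') = 2`, for
arbitrarily large `k`. Two consecutive traces exceeding 2 in modulus would force escape on a whole
neighbourhood of `E`, so this never happens on the spectrum. The invariant of the trace map then
gives `|x_k| ≤ 2 + V` (`abs_traceSeq_le`).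

Upper bound: at phase zero, Cayley-Hamilton expresses a long transfer matrix through shorter ones
with coefficient `x_k`, at the cost of a factor `3 + V` per Fibonacci level
(`mnorm_fibTransfer_zero_le`). A window of any phase is a phase-zero window, cut at the origin into
two such pieces, the left one reflected. This gives `(3 + V)^(2n)` at length about `φ^n`, hence the
exponent `1/2 + 2 log(3+V)/log φ`, which `three_add_le` shows to be below the stated one.

Lower bound: among four consecutive orders one has no crossing in the relevant window
(`exists_cross_free`). Over it the potential repeats, so `u(j) = x_k u(j + fib k) - u(j + 2 fib k)`.
The mass on `[1, fib m]` thus reappears further right, and total mass grows by a fixed factor every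
six levels (`IsSolution.mass_reproduction`). -/

theorem alpha_sq : alpha ^ 2 = 1 - alpha := by
  unfold alpha
  have := Real.sq_sqrt (show (0 : ℝ) ≤ 5 by norm_num)
  nlinarith

theorem alpha_pos : 0 < alpha := by
  unfold alpha
  have : (1 : ℝ) < Real.sqrt 5 := by
    rw [Real.lt_sqrt] <;> norm_num
  linarith

theorem alpha_lt_one : alpha < 1 := by nlinarith [alpha_sq, alpha_pos]

/-- The signed distance of `fib k * α` to the nearest integer. -/
noncomputable def eps (k : ℕ) : ℝ := -(-alpha) ^ k

theorem eps_succ (k : ℕ) : eps (k + 1) = -alpha * eps k := by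
  unfold eps; ring

theorem eps_ne_zero (k : ℕ) : eps k ≠ 0 :=
  neg_ne_zero.2 (pow_ne_zero _ (neg_ne_zero.2 alpha_pos.ne'))

/-- The numerator of the `k`-th convergent `fibNum k / fib k` of `α`. -/
def fibNum (k : ℕ) : ℤ := (Nat.fib (k + 1) : ℤ) - Nat.fib k

theorem fib_mul_alpha (k : ℕ) : (Nat.fib k : ℝ) * alpha = fibNum k + eps k := by
  have h : (Nat.fib k : ℝ) * alpha = fibNum k + eps k ∧
      (Nat.fib (k + 1) : ℝ) * alpha = fibNum (k + 1) + eps (k + 1) := by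
    induction k with
    | zero => simp [fibNum, eps]
    | succ k ih =>
      obtain ⟨h1, h2⟩ := ih
      refine ⟨h2, ?_⟩
      have e : eps (k + 1 + 1) = eps k + eps (k + 1) := by
        rw [eps_succ (k + 1), eps_succ]
        linear_combination eps k * alpha_sq
      have e2 : fibNum (k + 1 + 1) = fibNum k + fibNum (k + 1) := by
        simp only [fibNum, Nat.fib_add_two]; push_cast; ring
      rw [e, e2, Nat.fib_add_two]; push_cast
      linear_combination h1 + h2
  exact h.1

/-- Any pair of integers is an integer combination of two consecutive convergents. -/
theorem exists_fib_coords (k : ℕ) (r p : ℤ) :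
    ∃ a b : ℤ, r = a * Nat.fib k + b * Nat.fib (k + 1) ∧
      p = a * fibNum k + b * fibNum (k + 1) := by
  induction k with
  | zero => exact ⟨p, r, by simp, by simp [fibNum]⟩
  | succ k ih =>
    obtain ⟨a, b, h1, h2⟩ := ih
    refine ⟨b - a, a, ?_, ?_⟩
    · rw [h1, Nat.fib_add_two]; push_cast; ring
    · rw [h2]; simp only [fibNum, Nat.fib_add_two]; push_cast; ring

/-- Consecutive values of `eps` have ratio `-α`, so `rα - p` is `eps k` times `a - bα`. Every
return-time estimate below uses this: bounds on `a - bα` and the sign of `b` control the sign of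
`a`, hence the size of `r`. -/
theorem exists_coords (k : ℕ) (r p : ℤ) :
    ∃ a b : ℤ, r = a * Nat.fib k + b * Nat.fib (k + 1) ∧
      r * alpha - p = (a - b * alpha) * eps k := by
  obtain ⟨a, b, h1, h2⟩ := exists_fib_coords k r p
  refine ⟨a, b, h1, ?_⟩
  have e1 := fib_mul_alpha k
  have e2 := fib_mul_alpha (k + 1)
  rw [eps_succ] at e2
  rw [h1, h2]; push_cast
  linear_combination a * e1 + b * e2

theorem mul_alpha_ne_int (n p : ℤ) (hn : n ≠ 0) : (n : ℝ) * alpha ≠ p := by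
  have hirr : Irrational alpha := by
    have h5 : Irrational (Real.sqrt 5) := by
      simpa using Nat.Prime.irrational_sqrt (show Nat.Prime 5 by norm_num)
    have := (h5.sub_intCast 1).div_intCast (show (2 : ℤ) ≠ 0 by norm_num)
    simpa [alpha] using this
  intro h
  exact (hirr.intCast_mul hn).ne_int p h

/-- Rotation count `⌊nα + ω⌋`. -/
noncomputable def rot (ω : ℝ) (n : ℤ) : ℤ := ⌊n * alpha + ω⌋

/-- The floor of `x + α` jumps exactly when the fractional part of `x` is at least `1 - α`.
Repetitions of the potential thus become statements about `rot`. -/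
theorem potential_eq (V ω : ℝ) (n : ℤ) :
    potential V ω n = V * ((rot ω (n + 1) - rot ω n : ℤ) : ℝ) := by
  unfold potential rot
  set x := (n : ℝ) * alpha + ω with hx
  have e : ((n + 1 : ℤ) : ℝ) * alpha + ω = x + alpha := by rw [hx]; push_cast; ring
  rw [e]
  have h0 := Int.fract_nonneg x
  have h1 := Int.fract_lt_one x
  have h2 := Int.self_sub_floor x
  have ha := alpha_pos
  have ha1 := alpha_lt_one
  by_cases h : 1 - alpha ≤ Int.fract x
  · have : ⌊x + alpha⌋ = ⌊x⌋ + 1 := by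
      rw [Int.floor_eq_iff]; push_cast; constructor <;> linarith
    rw [if_pos ⟨h, h1⟩, this]; push_cast; ring
  · have : ⌊x + alpha⌋ = ⌊x⌋ := by
      rw [Int.floor_eq_iff]; push Not at h; constructor <;> linarith
    rw [if_neg (fun hh => h hh.1), this]; simp

/-- The `fib k`-step rotation starting at index `n` crosses an integer. -/
def Cross (ω : ℝ) (k : ℕ) (n : ℤ) : Prop := rot ω (n + Nat.fib k) ≠ rot ω n + fibNum k

theorem rot_add_fib (ω : ℝ) (k : ℕ) (n : ℤ) :
    rot ω (n + Nat.fib k) = ⌊n * alpha + ω + eps k⌋ + fibNum k := by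
  unfold rot
  rw [← Int.floor_add_intCast]
  congr 1
  push_cast
  linear_combination fib_mul_alpha k

theorem cross_iff (ω : ℝ) (k : ℕ) (n : ℤ) :
    Cross ω k n ↔ ⌊n * alpha + ω + eps k⌋ ≠ ⌊n * alpha + ω⌋ := by
  unfold Cross
  rw [rot_add_fib]
  simp [rot]

theorem floor_ne_imp {x e : ℝ} (h : ⌊x + e⌋ ≠ ⌊x⌋) (he1 : |e| ≤ 1) :
    ∃ P : ℤ, (0 < e ∧ P - e ≤ x ∧ x < P) ∨ (e < 0 ∧ P ≤ x ∧ x < P - e) := by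
  have h1 := Int.floor_le x
  have h2 := Int.lt_floor_add_one x
  have h3 := abs_le.1 he1
  rcases lt_trichotomy e 0 with h0 | h0 | h0
  · refine ⟨⌊x⌋, Or.inr ⟨h0, h1, ?_⟩⟩
    by_contra hc
    push Not at hc
    exact h (by rw [Int.floor_eq_iff]; constructor <;> linarith)
  · simp [h0] at h
  · refine ⟨⌊x⌋ + 1, Or.inl ⟨h0, ?_, by push_cast; linarith⟩⟩
    by_contra hc
    push Not at hc
    push_cast at hc
    exact h (by rw [Int.floor_eq_iff]; constructor <;> linarith)

theorem abs_eps_le (k : ℕ) : |eps k| ≤ 1 := by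
  unfold eps
  rw [abs_neg, abs_pow, abs_neg, abs_of_pos alpha_pos]
  exact pow_le_one₀ alpha_pos.le alpha_lt_one.le

/-- At a crossing the phase is, in units of `eps k`, in `[-1, 0]` modulo one. -/
theorem Cross.exists_phase {ω : ℝ} {k : ℕ} {n : ℤ} (h : Cross ω k n) :
    ∃ (P : ℤ) (s : ℝ), n * alpha + ω = P + s * eps k ∧ -1 ≤ s ∧ s ≤ 0 ∧
      (0 < eps k → s < 0) ∧ (eps k < 0 → -1 < s) := by
  rw [cross_iff] at h
  have ha := abs_eps_le k
  obtain ⟨P, hP⟩ := floor_ne_imp h ha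
  refine ⟨P, (n * alpha + ω - P) / eps k, ?_, ?_⟩
  · field_simp [eps_ne_zero k]; ring
  · rcases hP with ⟨h0, h1, h2⟩ | ⟨h0, h1, h2⟩
    · refine ⟨?_, ?_, fun _ => ?_, fun hc => absurd hc (by linarith)⟩
      · rw [le_div_iff₀ h0]; linarith
      · exact div_nonpos_of_nonpos_of_nonneg (by linarith) h0.le
      · exact div_neg_of_neg_of_pos (by linarith) h0
    · refine ⟨?_, ?_, fun hc => absurd hc (by linarith), fun _ => ?_⟩
      · rw [le_div_iff_of_neg h0]; linarith
      · exact div_nonpos_of_nonneg_of_nonpos (by linarith) h0.le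
      · rw [lt_div_iff_of_neg h0]; linarith

/-- Crossings of consecutive orders repel each other. -/
theorem Cross.sub_ge_or_le {ω : ℝ} {k : ℕ} {j j' : ℤ} (h : Cross ω k j)
    (h' : Cross ω (k + 1) j') :
    (Nat.fib k : ℤ) ≤ j' - j ∨ j' - j ≤ -(Nat.fib (k + 1) : ℤ) := by
  obtain ⟨P, s, e, h1, h2, h3, h4⟩ := h.exists_phase
  obtain ⟨P', s', e', h1', h2', h3', h4'⟩ := h'.exists_phase
  obtain ⟨a, b, hr, hp⟩ := exists_coords k (j' - j) (P' - P)
  have ha := alpha_pos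
  have ha1 := alpha_lt_one
  have key : (a : ℝ) - b * alpha = -alpha * s' - s := by
    have : ((a : ℝ) - b * alpha) * eps k = (-alpha * s' - s) * eps k := by
      rw [← hp]; rw [eps_succ] at e'; push_cast; linear_combination e' - e
    exact mul_right_cancel₀ (eps_ne_zero k) this
  -- Consecutive `eps` have opposite signs, so the half-open ends of the two phase intervals combine
  -- to make both inequalities strict.
  have hlt : 0 < (a : ℝ) - b * alpha ∧ (a : ℝ) - b * alpha < 1 + alpha := by
    rw [key]
    rw [eps_succ] at h3' h4'
    rcases lt_or_gt_of_ne (eps_ne_zero k) with hn | hn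
    · have := h4 hn
      have := h3' (by nlinarith)
      constructor <;> nlinarith
    · have := h3 hn
      have := h4' (by nlinarith)
      constructor <;> nlinarith
  have f0 : (0 : ℤ) ≤ Nat.fib k := by positivity
  have f1 : (0 : ℤ) ≤ Nat.fib (k + 1) := by positivity
  rw [hr]
  rcases lt_trichotomy b 0 with hb | hb | hb
  · right
    have hb' : (b : ℝ) ≤ -1 := by exact_mod_cast (by omega : b ≤ -1)
    have : (a : ℝ) < 1 := by nlinarith
    have : a < 1 := by exact_mod_cast this
    nlinarith
  · left
    subst hb
    have : (0 : ℝ) < a := by simpa using hlt.1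
    have : 0 < a := by exact_mod_cast this
    nlinarith
  · left
    have hb' : (0 : ℝ) < b := by exact_mod_cast hb
    have : (0 : ℝ) < a := by nlinarith
    have : 0 < a := by exact_mod_cast this
    nlinarith

/-- Consecutive integers are not both crossings. -/
theorem Cross.not_succ {ω : ℝ} {k : ℕ} (hk : 2 ≤ k) {j : ℤ} (h : Cross ω k j) :
    ¬ Cross ω k (j + 1) := by
  intro h'
  obtain ⟨P, s, e, h1, h2, h3, h4⟩ := h.exists_phase
  obtain ⟨P', s', e', h1', h2', h3', h4'⟩ := h'.exists_phase
  obtain ⟨a, b, hr, hp⟩ := exists_coords k 1 (P' - P)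
  have ha := alpha_pos
  have ha1 := alpha_lt_one
  have key : (a : ℝ) - b * alpha = s' - s := by
    have : ((a : ℝ) - b * alpha) * eps k = (s' - s) * eps k := by
      rw [← hp]; push_cast at e' ⊢; linear_combination e' - e
    exact mul_right_cancel₀ (eps_ne_zero k) this
  have hlt : -1 < (a : ℝ) - b * alpha ∧ (a : ℝ) - b * alpha < 1 := by
    rw [key]
    rcases lt_or_gt_of_ne (eps_ne_zero k) with hn | hn
    · have := h4 hn
      have := h4' hn
      constructor <;> linarith
    · have := h3 hn
      have := h3' hn
      constructor <;> linarith
  have f0 : (1 : ℤ) ≤ Nat.fib k := by exact_mod_cast Nat.fib_pos.2 (by omega)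
  have f1 : (2 : ℤ) ≤ Nat.fib (k + 1) := by
    exact_mod_cast (Nat.fib_mono (show 3 ≤ k + 1 by omega) : Nat.fib 3 ≤ _)
  rcases lt_trichotomy b 0 with hb | hb | hb
  · have hb' : (b : ℝ) < 0 := by exact_mod_cast hb
    have : (a : ℝ) < 1 := by nlinarith
    have : a < 1 := by exact_mod_cast this
    nlinarith
  · subst hb
    have h5 : (-1 : ℝ) < a := by simpa using hlt.1
    have h6 : (a : ℝ) < 1 := by simpa using hlt.2
    have h5 : -1 < a := by exact_mod_cast h5
    have h6 : a < 1 := by exact_mod_cast h6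
    have : a = 0 := by omega
    simp [this] at hr
  · have hb' : (0 : ℝ) < b := by exact_mod_cast hb
    have : (-1 : ℝ) < a := by nlinarith
    have : -1 < a := by exact_mod_cast this
    nlinarith

/-- To the right of a crossing, the rotation follows the one with phase zero. -/
theorem Cross.rot_add {ω : ℝ} {k : ℕ} {n : ℤ} (h : Cross ω k n) :
    ∃ P : ℤ, ∀ i : ℤ, 1 ≤ i → i < Nat.fib (k + 2) → rot ω (n + i) = P + rot 0 i := by
  obtain ⟨P, s, e, h1, h2, h3, h4⟩ := h.exists_phase
  refine ⟨P, fun i hi hi' => ?_⟩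
  have e1 : rot ω (n + i) = ⌊i * alpha + s * eps k⌋ + P := by
    unfold rot
    rw [← Int.floor_add_intCast]
    congr 1
    push_cast
    linear_combination e
  have ha := alpha_pos
  have ha1 := alpha_lt_one
  rw [e1, add_comm]
  congr 1
  unfold rot
  rw [add_zero]
  by_contra hne
  have hb : |s * eps k| ≤ 1 := by
    rw [abs_mul]
    exact mul_le_one₀ (abs_le.2 ⟨h1, by linarith⟩) (abs_nonneg _) (abs_eps_le k)
  obtain ⟨Q, hQ⟩ := floor_ne_imp hne hb
  obtain ⟨a, b, hr, hp⟩ := exists_coords k i Q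
  have hlt : 0 ≤ (a : ℝ) - b * alpha ∧ (a : ℝ) - b * alpha < 1 := by
    rcases lt_or_gt_of_ne (eps_ne_zero k) with hn | hn
    · have := h4 hn
      rcases hQ with ⟨h0, h5, h6⟩ | ⟨h0, h5, h6⟩
      · constructor <;> nlinarith
      · nlinarith
    · have := h3 hn
      rcases hQ with ⟨h0, h5, h6⟩ | ⟨h0, h5, h6⟩
      · nlinarith
      · constructor <;> nlinarith
  have f0 : (0 : ℤ) ≤ Nat.fib k := by positivity
  have f1 : (0 : ℤ) ≤ Nat.fib (k + 1) := by positivity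
  have f2 : (Nat.fib (k + 2) : ℤ) = Nat.fib k + Nat.fib (k + 1) := by
    exact_mod_cast Nat.fib_add_two
  -- Only `b > 0` allows `i ≥ 1`; then also `a ≥ 1`, so `i` is at least `fib k + fib (k + 1) = fib
  -- (k + 2)`.
  rcases lt_trichotomy b 0 with hb | hb | hb
  · have hb' : (b : ℝ) < 0 := by exact_mod_cast hb
    have : (a : ℝ) < 1 := by nlinarith
    have : a < 1 := by exact_mod_cast this
    nlinarith
  · subst hb
    have h5 : (a : ℝ) < 1 := by simpa using hlt.2
    have h5 : a < 1 := by exact_mod_cast h5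
    nlinarith
  · have hb' : (0 : ℝ) < b := by exact_mod_cast hb
    have : (0 : ℝ) < a := by nlinarith
    have : 0 < a := by exact_mod_cast this
    nlinarith

/-- The phase-zero rotation has a crossing at a positive index only from `fib (k + 1)` on, and at
negative indices only up to `-fib k`. -/
theorem Cross.zero_ge {k : ℕ} {r : ℤ} (h : Cross 0 k r) :
    r = 0 ∨ (Nat.fib (k + 1) : ℤ) ≤ r ∨ r ≤ -(Nat.fib k : ℤ) := by
  obtain ⟨P, s, e, h1, h2, h3, h4⟩ := h.exists_phase
  obtain ⟨a, b, hr, hp⟩ := exists_coords k r P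
  have ha := alpha_pos
  have ha1 := alpha_lt_one
  have key : (a : ℝ) - b * alpha = s := by
    have : ((a : ℝ) - b * alpha) * eps k = s * eps k := by
      rw [← hp]; linear_combination e
    exact mul_right_cancel₀ (eps_ne_zero k) this
  have f0 : (0 : ℤ) ≤ Nat.fib k := by positivity
  have f1 : (0 : ℤ) ≤ Nat.fib (k + 1) := by positivity
  rw [← key] at h1 h2
  rcases lt_trichotomy b 0 with hb | hb | hb
  · right; right
    have hb' : (b : ℝ) < 0 := by exact_mod_cast hb
    have : (a : ℝ) < 0 := by nlinarith
    have : a < 0 := by exact_mod_cast this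
    nlinarith
  · subst hb
    have h5 : (a : ℝ) ≤ 0 := by simpa using h2
    have h5 : a ≤ 0 := by exact_mod_cast h5
    rcases h5.lt_or_eq with h6 | h6
    · right; right; nlinarith
    · left; simp [hr, h6]
  · right; left
    have hb' : (0 : ℝ) < b := by exact_mod_cast hb
    have : (-1 : ℝ) < a := by nlinarith
    have : -1 < a := by exact_mod_cast this
    nlinarith

/-- Without crossings to the left, each step back by `fib k` would shift the phase by `-eps k` and
never change its floor, which is impossible once the total shift exceeds one. -/
theorem exists_cross_le (ω : ℝ) (k : ℕ) (s : ℤ) : ∃ n ≤ s, Cross ω k n := by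
  by_contra hc
  push Not at hc
  have hc' : ∀ n ≤ s, rot ω (n + Nat.fib k) = rot ω n + fibNum k := fun n hn => by
    have := hc n hn
    unfold Cross at this
    exact not_not.1 this
  have f0 : (0 : ℤ) ≤ Nat.fib k := by positivity
  have hm : ∀ m : ℕ, ⌊s * alpha + ω - m * eps k⌋ = ⌊s * alpha + ω⌋ := by
    intro m
    have h1 : rot ω (s - m * Nat.fib k) = rot ω s - m * fibNum k := by
      induction m with
      | zero => simp
      | succ m ih =>
        have := hc' (s - (m + 1 : ℕ) * Nat.fib k) (by
          have : (0 : ℤ) ≤ (m + 1 : ℕ) * Nat.fib k := by positivity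
          linarith)
        rw [show s - ((m + 1 : ℕ) : ℤ) * Nat.fib k + Nat.fib k = s - m * Nat.fib k by
          push_cast; ring, ih] at this
        push_cast at this ⊢
        linarith
    have h2 : rot ω (s - m * Nat.fib k) = ⌊s * alpha + ω - m * eps k⌋ - m * fibNum k := by
      unfold rot
      rw [eq_sub_iff_add_eq, show (m : ℤ) * fibNum k = ((m * fibNum k : ℤ)) from rfl,
        ← Int.floor_add_intCast]
      congr 1
      push_cast
      linear_combination (-(m : ℝ)) * fib_mul_alpha k
    unfold rot at h1 h2
    linarith
  obtain ⟨m, hm'⟩ := exists_nat_gt (1 / |eps k|)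
  have hpos : 0 < |eps k| := abs_pos.2 (eps_ne_zero k)
  rw [div_lt_iff₀ hpos] at hm'
  have h1 := hm m
  rw [Int.floor_eq_iff] at h1
  have h2 := Int.floor_le ((s : ℝ) * alpha + ω)
  have h3 := Int.lt_floor_add_one ((s : ℝ) * alpha + ω)
  rcases abs_cases (eps k) with ⟨h4, _⟩ | ⟨h4, _⟩ <;> rw [h4] at hm' <;> nlinarith

/-- A window free of crossings of some order, for arbitrary phase and at all scales. -/
theorem exists_cross_free (ω : ℝ) (m : ℕ) (s : ℤ) :
    ∃ k, m + 1 ≤ k ∧ k ≤ m + 4 ∧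
      ∀ n : ℤ, s + 1 ≤ n → n ≤ s + (Nat.fib k + Nat.fib m) → ¬ Cross ω k n := by
  by_contra hc
  push Not at hc
  obtain ⟨j0, a0, b0, c0⟩ := hc (m + 1) (by omega) (by omega)
  obtain ⟨j1, a1, b1, c1⟩ := hc (m + 2) (by omega) (by omega)
  obtain ⟨j2, a2, b2, c2⟩ := hc (m + 3) (by omega) (by omega)
  obtain ⟨j3, a3, b3, c3⟩ := hc (m + 4) (by omega) (by omega)
  -- The window lengths rule out the leftward alternative of each repulsion. So the four crossings
  -- move right by at least `fib (m+1)`, `fib (m+2)`, `fib (m+3)`, which takes the last one out of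
  -- its window.
  have d0 := c0.sub_ge_or_le c1
  have d1 := c1.sub_ge_or_le c2
  have d2 := c2.sub_ge_or_le c3
  have e2 : Nat.fib (m + 2) = Nat.fib m + Nat.fib (m + 1) := Nat.fib_add_two
  have e3 : Nat.fib (m + 3) = Nat.fib (m + 1) + Nat.fib (m + 2) := Nat.fib_add_two
  have e4 : Nat.fib (m + 4) = Nat.fib (m + 2) + Nat.fib (m + 3) := Nat.fib_add_two
  have em : Nat.fib m ≤ Nat.fib (m + 1) := Nat.fib_le_fib_succ
  simp only [Nat.add_assoc, Nat.reduceAdd] at *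
  omega

/-! ### Local repetitions and reflections of the potential. -/

theorem potential_congr_of_not_cross {ω : ℝ} {k : ℕ} {n : ℤ} (V : ℝ) (h : ¬ Cross ω k n)
    (h' : ¬ Cross ω k (n + 1)) : potential V ω (n + Nat.fib k) = potential V ω n := by
  unfold Cross at h h'
  rw [not_not] at h h'
  rw [potential_eq, potential_eq, h, show n + (Nat.fib k : ℤ) + 1 = n + 1 + Nat.fib k by ring, h']
  congr 2; ring

theorem Cross.potential_add {ω : ℝ} {k : ℕ} {n : ℤ} (V : ℝ) (h : Cross ω k n) {i : ℤ}
    (hi : 1 ≤ i) (hi' : i + 1 < Nat.fib (k + 2)) :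
    potential V ω (n + i) = potential V 0 i := by
  obtain ⟨P, hP⟩ := h.rot_add
  rw [potential_eq, potential_eq, hP i hi (by linarith), add_assoc, hP (i + 1) (by linarith) hi']
  congr 2; ring

theorem potential_zero_add_fib (V : ℝ) (k : ℕ) {i : ℤ} (hi : 1 ≤ i)
    (hi' : i + 1 < Nat.fib (k + 1)) : potential V 0 (i + Nat.fib k) = potential V 0 i := by
  have f0 : (0 : ℤ) ≤ Nat.fib k := by positivity
  refine potential_congr_of_not_cross V (fun h => ?_) (fun h => ?_) <;>
  · rcases h.zero_ge with h | h | h <;> linarith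

theorem rot_zero_neg {n : ℤ} (hn : n ≠ 0) : rot 0 (-n) = -rot 0 n - 1 := by
  unfold rot
  have h1 := Int.floor_le ((n : ℝ) * alpha + 0)
  have h2 := Int.lt_floor_add_one ((n : ℝ) * alpha + 0)
  have h3 := mul_alpha_ne_int n ⌊(n : ℝ) * alpha + 0⌋ hn
  have h4 : (⌊(n : ℝ) * alpha + 0⌋ : ℝ) < n * alpha :=
    lt_of_le_of_ne (by linarith) h3.symm
  rw [Int.floor_eq_iff]
  push_cast
  constructor <;> linarith

/-- Reflection symmetry of the phase-zero potential. -/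
theorem potential_zero_reflect (V : ℝ) {i : ℤ} (hi : 1 ≤ i) :
    potential V 0 (-1 - i) = potential V 0 i := by
  rw [potential_eq, potential_eq, show -1 - i + 1 = -i by ring, show -1 - i = -(i + 1) by ring,
    rot_zero_neg (by omega), rot_zero_neg (by omega)]
  congr 2; ring

/-- Reflection about the origin followed by translation by `fib k`: a Fibonacci block is a
palindrome up to its last two sites. -/
theorem potential_zero_fib_reflect (V : ℝ) (k : ℕ) {i : ℤ} (hi : 1 ≤ i)
    (hi' : i + 1 < Nat.fib k) : potential V 0 (Nat.fib k - 1 - i) = potential V 0 i := by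
  rw [← potential_zero_reflect V hi, show (Nat.fib k : ℤ) - 1 - i = -1 - i + Nat.fib k by ring]
  refine potential_congr_of_not_cross V (fun h => ?_) (fun h => ?_) <;>
  · rcases h.zero_ge with h | h | h
    · linarith
    · have : (0 : ℤ) ≤ Nat.fib (k + 1) := by positivity
      linarith
    · linarith

/-- Every window of the potential with phase `ω` is a window around the origin of the potential
with phase zero. -/
theorem exists_potential_eq_zero_phase (ω : ℝ) (N : ℕ) :
    ∃ j : ℤ, 0 ≤ j ∧ j ≤ N + 1 ∧
      ∀ V : ℝ, ∀ i : ℤ, 0 ≤ i → i ≤ N → potential V ω i = potential V 0 (i - j) := by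
  -- The smallest fractional part can be subtracted from the phase without changing any floor in the
  -- window; afterwards the phase at `j` is an integer.
  obtain ⟨j, hj, hmin⟩ := Finset.exists_min_image (Finset.Icc (0 : ℤ) (N + 1))
    (fun j => Int.fract (j * alpha + ω)) ⟨0, by simp; positivity⟩
  rw [Finset.mem_Icc] at hj
  refine ⟨j, hj.1, hj.2, ?_⟩
  have key : ∀ i : ℤ, 0 ≤ i → i ≤ N + 1 → rot ω i = rot 0 (i - j) + rot ω j := by
    intro i h0 h1
    have hm := hmin i (Finset.mem_Icc.2 ⟨h0, h1⟩)
    unfold rot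
    rw [← Int.floor_add_intCast, add_zero]
    have e : (((i - j : ℤ) : ℝ) * alpha + (⌊(j : ℝ) * alpha + ω⌋ : ℝ)) =
        i * alpha + ω - Int.fract (j * alpha + ω) := by
      rw [Int.fract]; push_cast; ring
    rw [e]
    symm
    rw [Int.floor_eq_iff]
    have h2 := Int.self_sub_fract ((i : ℝ) * alpha + ω)
    have h3 := Int.fract_lt_one ((i : ℝ) * alpha + ω)
    have h4 := Int.fract_nonneg ((j : ℝ) * alpha + ω)
    constructor <;> linarith
  intro V i h0 h1
  rw [potential_eq, potential_eq, key i h0 (by linarith), key (i + 1) (by linarith) (by linarith)]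
  congr 2
  rw [show i + 1 - j = i - j + 1 by ring]; ring

/-! ### Transfer matrices -/

/-- One-step transfer matrix. -/
def stepMat (x : ℝ) : Matrix (Fin 2) (Fin 2) ℝ := !![x, -1; 1, 0]

/-- The transfer matrix over the sites `s + 1, …, s + n` for the sequence `d = E - v`. -/
def transfer (d : ℤ → ℝ) (s : ℤ) : ℕ → Matrix (Fin 2) (Fin 2) ℝ
  | 0 => 1
  | n + 1 => stepMat (d (s + n + 1)) * transfer d s n

theorem det_stepMat (x : ℝ) : (stepMat x).det = 1 := by
  simp [stepMat, Matrix.det_fin_two]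

theorem det_transfer (d : ℤ → ℝ) (s : ℤ) (n : ℕ) : (transfer d s n).det = 1 := by
  induction n with
  | zero => simp [transfer]
  | succ n ih => rw [transfer, Matrix.det_mul, ih, det_stepMat, one_mul]

theorem transfer_add (d : ℤ → ℝ) (s : ℤ) (m n : ℕ) :
    transfer d s (m + n) = transfer d (s + m) n * transfer d s m := by
  induction n with
  | zero => simp [transfer]
  | succ n ih =>
    rw [← add_assoc, transfer, ih, transfer, Matrix.mul_assoc]
    congr 3
    push_cast; ring

theorem transfer_one (d : ℤ → ℝ) (s : ℤ) : transfer d s 1 = stepMat (d (s + 1)) := by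
  simp [transfer]

theorem transfer_congr {d d' : ℤ → ℝ} {s s' : ℤ} {n : ℕ}
    (h : ∀ i : ℤ, 1 ≤ i → i ≤ n → d (s + i) = d' (s' + i)) :
    transfer d s n = transfer d' s' n := by
  induction n with
  | zero => rfl
  | succ n ih =>
    rw [transfer, transfer, ih (fun i h0 h1 => h i h0 (by push_cast; linarith)), add_assoc,
      h (n + 1) (by linarith [Int.natCast_nonneg n]) (by push_cast; rfl), add_assoc]

theorem transfer_succ' (d : ℤ → ℝ) (s : ℤ) (n : ℕ) :
    transfer d s (n + 1) = transfer d (s + 1) n * stepMat (d (s + 1)) := by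
  rw [add_comm, transfer_add, transfer_one]; simp

/-- When the site entering the window carries the same value as the one leaving it, the shift is a
conjugation by a one-step matrix. -/
theorem trace_transfer_shift {d : ℤ → ℝ} {s : ℤ} {n : ℕ} (h : d (s + 1 + n) = d (s + 1)) :
    (transfer d (s + 1) n).trace = (transfer d s n).trace := by
  have h1 := transfer_succ' d s n
  rw [transfer, show s + (n : ℤ) + 1 = s + 1 + n by ring, h] at h1
  set A := stepMat (d (s + 1)) with hA
  have hdet : IsUnit A.det := by rw [hA, det_stepMat]; exact isUnit_one
  have h2 : transfer d (s + 1) n = A * transfer d s n * A⁻¹ := by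
    rw [h1, Matrix.mul_assoc, Matrix.mul_nonsing_inv _ hdet, Matrix.mul_one]
  rw [h2, Matrix.mul_assoc, Matrix.trace_mul_comm, Matrix.mul_assoc,
    Matrix.nonsing_inv_mul _ hdet, Matrix.mul_one]

theorem mul_self_eq_of_det_one {M : Matrix (Fin 2) (Fin 2) ℝ} (h : M.det = 1) :
    M * M = M.trace • M - 1 := by
  rw [Matrix.det_fin_two] at h
  ext i j
  fin_cases i <;> fin_cases j <;>
    simp [Matrix.mul_apply, Fin.sum_univ_two, Matrix.trace_fin_two] <;>
    first | ring1 | linear_combination -h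

/-- `ABA = B⁻¹(BA)²`, and Cayley-Hamilton applies to `BA`. It treats a period followed by part of
itself. -/
theorem mul_mul_self_eq {A B : Matrix (Fin 2) (Fin 2) ℝ} (hA : A.det = 1) (hB : B.det = 1) :
    A * B * A = (B * A).trace • A - B.adjugate := by
  have h1 := mul_self_eq_of_det_one (M := B * A) (by rw [Matrix.det_mul, hA, hB, one_mul])
  have h2 : B.adjugate * B = 1 := by rw [Matrix.adjugate_mul, hB, one_smul]
  calc A * B * A = B.adjugate * ((B * A) * (B * A)) := by
        rw [← Matrix.mul_assoc B.adjugate, ← Matrix.mul_assoc B.adjugate, h2, Matrix.one_mul,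
          Matrix.mul_assoc]
    _ = _ := by
        rw [h1, Matrix.mul_sub, Matrix.mul_smul, ← Matrix.mul_assoc, h2, Matrix.one_mul,
          Matrix.mul_one]

/-- Cyclicity turns this into the trace of `AB²`, and Cayley-Hamilton for `B` gives the trace map.
-/
theorem trace_mul_mul_self {A B : Matrix (Fin 2) (Fin 2) ℝ} (hB : B.det = 1) :
    (B * (A * B)).trace = B.trace * (A * B).trace - A.trace := by
  rw [Matrix.trace_mul_comm, Matrix.mul_assoc, mul_self_eq_of_det_one hB, Matrix.mul_sub,
    Matrix.mul_smul, Matrix.trace_sub, Matrix.trace_smul, Matrix.mul_one, smul_eq_mul]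

/-- The sum of the absolute values of the entries. -/
def mnorm (M : Matrix (Fin 2) (Fin 2) ℝ) : ℝ := |M 0 0| + |M 0 1| + |M 1 0| + |M 1 1|

theorem mnorm_nonneg (M : Matrix (Fin 2) (Fin 2) ℝ) : 0 ≤ mnorm M := by
  unfold mnorm; positivity

theorem mnorm_mul_le (M N : Matrix (Fin 2) (Fin 2) ℝ) : mnorm (M * N) ≤ mnorm M * mnorm N := by
  unfold mnorm
  simp only [Matrix.mul_apply, Fin.sum_univ_two]
  have h : ∀ a b c d : ℝ, |a * b + c * d| ≤ |a| * |b| + |c| * |d| := fun a b c d => by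
    rw [← abs_mul, ← abs_mul]; exact abs_add_le _ _
  have h1 := h (M 0 0) (N 0 0) (M 0 1) (N 1 0)
  have h2 := h (M 0 0) (N 0 1) (M 0 1) (N 1 1)
  have h3 := h (M 1 0) (N 0 0) (M 1 1) (N 1 0)
  have h4 := h (M 1 0) (N 0 1) (M 1 1) (N 1 1)
  have p : ∀ a b : ℝ, 0 ≤ |a| * |b| := fun a b => by positivity
  nlinarith [p (M 0 0) (N 1 0), p (M 0 0) (N 1 1), p (M 0 1) (N 0 0), p (M 0 1) (N 0 1),
    p (M 1 0) (N 1 0), p (M 1 0) (N 1 1), p (M 1 1) (N 0 0), p (M 1 1) (N 0 1)]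

theorem mnorm_smul_sub_le (t : ℝ) (M N : Matrix (Fin 2) (Fin 2) ℝ) :
    mnorm (t • M - N) ≤ |t| * mnorm M + mnorm N := by
  unfold mnorm
  simp only [Matrix.sub_apply, Matrix.smul_apply, smul_eq_mul]
  have h : ∀ b c : ℝ, |t * b - c| ≤ |t| * |b| + |c| := fun b c => by
    rw [← abs_mul]; exact abs_sub _ _
  linarith [h (M 0 0) (N 0 0), h (M 0 1) (N 0 1), h (M 1 0) (N 1 0), h (M 1 1) (N 1 1)]

theorem mnorm_adjugate (M : Matrix (Fin 2) (Fin 2) ℝ) : mnorm M.adjugate = mnorm M := by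
  simp [mnorm, Matrix.adjugate_fin_two]; ring

theorem mnorm_stepMat (x : ℝ) : mnorm (stepMat x) = |x| + 2 := by
  simp [mnorm, stepMat]; ring

theorem mnorm_one : mnorm 1 = 2 := by
  simp [mnorm]; norm_num

/-- Reversing the order of the sites does not change the size of the transfer matrix. -/
theorem mnorm_transfer_reverse {d d' : ℤ → ℝ} {s s' : ℤ} {n : ℕ}
    (h : ∀ i : ℤ, 1 ≤ i → i ≤ n → d' (s' + i) = d (s + n + 1 - i)) :
    mnorm (transfer d' s' n) = mnorm (transfer d s n) := by
  -- The map `M ↦ D Mᵀ D` with `D = diag(1, -1)` reverses products and fixes every one-step matrix.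
  have key : ∀ (n : ℕ) (s : ℤ), (∀ i : ℤ, 1 ≤ i → i ≤ n → d' (s' + i) = d (s + n + 1 - i)) →
      transfer d' s' n = !![transfer d s n 0 0, -transfer d s n 1 0;
        -transfer d s n 0 1, transfer d s n 1 1] := by
    intro n
    induction n with
    | zero =>
      intro s _
      ext i j; fin_cases i <;> fin_cases j <;> simp [transfer]
    | succ n ih =>
      intro s h
      have h1 := ih (s + 1) (fun i h0 h1 => by
        rw [h i h0 (by push_cast; linarith)]; congr 1; push_cast; ring)
      have h2 := h (n + 1) (by linarith [Int.natCast_nonneg n]) (by push_cast; rfl)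
      rw [transfer, h1, transfer_succ', add_assoc, h2]
      have e : s + ((n + 1 : ℕ) : ℤ) + 1 - (n + 1) = s + 1 := by push_cast; ring
      rw [e]
      ext i j
      fin_cases i <;> fin_cases j <;>
        simp [stepMat, Matrix.mul_apply, Fin.sum_univ_two] <;> ring1
  rw [key n s h]
  simp [mnorm]; ring

/-! ### Solutions and transfer matrices. -/

theorem solution_transfer {d : ℤ → ℝ} {u : ℤ → ℂ}
    (h : ∀ n : ℤ, u (n + 1) = d n * u n - u (n - 1)) (s : ℤ) (n : ℕ) :
    u (s + n + 1) = (transfer d s n 0 0 : ℝ) * u (s + 1) + (transfer d s n 0 1 : ℝ) * u s ∧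
    u (s + n) = (transfer d s n 1 0 : ℝ) * u (s + 1) + (transfer d s n 1 1 : ℝ) * u s := by
  induction n with
  | zero => simp [transfer]
  | succ n ih =>
    obtain ⟨h1, h2⟩ := ih
    have h3 := h (s + n + 1)
    rw [show s + (n : ℤ) + 1 - 1 = s + n by ring] at h3
    push_cast
    rw [← add_assoc, h3, h1, h2]
    simp only [transfer, stepMat, Matrix.mul_apply, Fin.sum_univ_two]
    constructor <;> simp <;> ring

/-- This is `M² - (tr M) M + 1 = 0` applied to `(u(s+1), u(s))`, read in the second coordinate. -/
theorem solution_square {d : ℤ → ℝ} {u : ℤ → ℂ}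
    (h : ∀ n : ℤ, u (n + 1) = d n * u n - u (n - 1)) {s : ℤ} {n : ℕ}
    (hs : ∀ i : ℤ, 1 ≤ i → i ≤ n → d (s + n + i) = d (s + i)) :
    u s = ((transfer d s n).trace : ℝ) * u (s + n) - u (s + 2 * n) := by
  obtain ⟨h1, h2⟩ := solution_transfer h s n
  obtain ⟨h3, h4⟩ := solution_transfer h (s + n) n
  rw [transfer_congr hs] at h3 h4
  have hd := det_transfer d s n
  rw [Matrix.det_fin_two] at hd
  have hd' : ((transfer d s n 0 0 : ℝ) : ℂ) * (transfer d s n 1 1 : ℝ) -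
      (transfer d s n 0 1 : ℝ) * (transfer d s n 1 0 : ℝ) = 1 := by exact_mod_cast hd
  rw [Matrix.trace_fin_two, show s + 2 * (n : ℤ) = s + n + n by ring, h4, h2, h1]
  push_cast
  linear_combination -u s * hd'

/-! ### Traces over Fibonacci windows -/

/-- The sequence of traces, extended backwards by the trace map. -/
def traceSeq (V E : ℝ) : ℕ → ℝ
  | 0 => 2
  | 1 => E
  | 2 => E - V
  | n + 3 => traceSeq V E (n + 2) * traceSeq V E (n + 1) - traceSeq V E n

/-- The transfer matrix of the Fibonacci Hamiltonian. -/
noncomputable def fibTransfer (V ω E : ℝ) : ℤ → ℕ → Matrix (Fin 2) (Fin 2) ℝ :=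
  transfer (fun n => E - potential V ω n)

theorem rot_zero_one : rot 0 1 = 0 := by
  unfold rot
  rw [Int.floor_eq_iff]
  constructor <;> push_cast <;> linarith [alpha_pos, alpha_lt_one]

theorem alpha_bounds : 3 / 5 < alpha ∧ alpha < 2 / 3 := by
  constructor <;> nlinarith [alpha_sq, alpha_pos]

theorem rot_zero_two : rot 0 2 = 1 := by
  unfold rot
  rw [Int.floor_eq_iff]
  constructor <;> push_cast <;> linarith [alpha_bounds.1, alpha_bounds.2]

theorem rot_zero_three : rot 0 3 = 1 := by
  unfold rot
  rw [Int.floor_eq_iff]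
  constructor <;> push_cast <;> linarith [alpha_bounds.1, alpha_bounds.2]

theorem rot_zero_four : rot 0 4 = 2 := by
  unfold rot
  rw [Int.floor_eq_iff]
  constructor <;> push_cast <;> linarith [alpha_bounds.1, alpha_bounds.2]

theorem potential_zero_one (V : ℝ) : potential V 0 1 = V := by
  rw [potential_eq]; norm_num [rot_zero_one, rot_zero_two]

theorem potential_zero_two (V : ℝ) : potential V 0 2 = 0 := by
  rw [potential_eq]; norm_num [rot_zero_two, rot_zero_three]

theorem potential_zero_three (V : ℝ) : potential V 0 3 = V := by
  rw [potential_eq]; norm_num [rot_zero_three, rot_zero_four]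

/-- The sites after `fib (k+1)` repeat the first `fib k` ones. With `k ≥ 2` one has `fib (k+1) ≥ 2`,
so the last of them is still in the range of repetition. -/
theorem fibTransfer_fib_add_two (V E : ℝ) {k : ℕ} (hk : 2 ≤ k) :
    fibTransfer V 0 E 0 (Nat.fib (k + 2)) =
      fibTransfer V 0 E 0 (Nat.fib k) * fibTransfer V 0 E 0 (Nat.fib (k + 1)) := by
  unfold fibTransfer
  rw [Nat.fib_add_two, add_comm, transfer_add]
  congr 1
  refine transfer_congr (fun i h0 h1 => ?_)
  have e : (Nat.fib (k + 2) : ℤ) = Nat.fib k + Nat.fib (k + 1) := by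
    exact_mod_cast Nat.fib_add_two
  have e1 : (2 : ℤ) ≤ Nat.fib (k + 1) := by
    exact_mod_cast (Nat.fib_mono (show 3 ≤ k + 1 by omega) : Nat.fib 3 ≤ _)
  simp only [zero_add]
  rw [add_comm, potential_zero_add_fib V (k + 1) h0 (by rw [add_assoc]; linarith)]

theorem trace_fibTransfer_zero (V E : ℝ) {k : ℕ} (hk : 2 ≤ k) :
    (fibTransfer V 0 E 0 (Nat.fib k)).trace = traceSeq V E k := by
  have h2 : fibTransfer V 0 E 0 1 = stepMat (E - V) := by
    simp [fibTransfer, transfer, potential_zero_one]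
  have h3 : fibTransfer V 0 E 0 2 = stepMat E * stepMat (E - V) := by
    have : fibTransfer V 0 E 0 2 = stepMat (E - potential V 0 2) * fibTransfer V 0 E 0 1 := rfl
    rw [this, h2, potential_zero_two, sub_zero]
  have h4 : fibTransfer V 0 E 0 3 = stepMat (E - V) * (stepMat E * stepMat (E - V)) := by
    have : fibTransfer V 0 E 0 3 = stepMat (E - potential V 0 3) * fibTransfer V 0 E 0 2 := rfl
    rw [this, h3, potential_zero_three]
  have key : ∀ j : ℕ,
      (fibTransfer V 0 E 0 (Nat.fib (j + 2))).trace = traceSeq V E (j + 2) ∧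
      (fibTransfer V 0 E 0 (Nat.fib (j + 3))).trace = traceSeq V E (j + 3) ∧
      (fibTransfer V 0 E 0 (Nat.fib (j + 4))).trace = traceSeq V E (j + 4) := by
    intro j
    induction j with
    | zero =>
      norm_num [Nat.fib, h2, h3, h4, traceSeq, stepMat, Matrix.trace_fin_two,
        Matrix.mul_apply, Fin.sum_univ_two]
      constructor <;> ring1
    | succ j ih =>
      obtain ⟨a, b, c⟩ := ih
      refine ⟨b, c, ?_⟩
      rw [fibTransfer_fib_add_two V E (show 2 ≤ j + 3 by omega),
        fibTransfer_fib_add_two V E (show 2 ≤ j + 2 by omega)]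
      have hd : (fibTransfer V 0 E 0 (Nat.fib (j + 2 + 1))).det = 1 := det_transfer _ _ _
      rw [show j + 3 = j + 2 + 1 from rfl, trace_mul_mul_self hd,
        ← fibTransfer_fib_add_two V E (show 2 ≤ j + 2 by omega)]
      rw [show j + 2 + 1 = j + 3 from rfl, show j + 2 + 2 = j + 4 from rfl, a, b, c]
      exact mul_comm (traceSeq V E (j + 3)) _ ▸ rfl
  obtain ⟨j, rfl⟩ := Nat.exists_eq_add_of_le hk
  rw [add_comm]
  exact (key j).1

/-- The trace over a window of Fibonacci length is given by the trace sequence, unless a crossing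
occurs right at its start. -/
theorem trace_fibTransfer (V ω E : ℝ) {k : ℕ} (hk : 2 ≤ k) {s : ℤ} (hs : ¬ Cross ω k (s + 1)) :
    (fibTransfer V ω E s (Nat.fib k)).trace = traceSeq V E k := by
  -- Start at the last crossing up to `s`, where the window agrees with the phase-zero one, and
  -- slide right to `s`; with no crossing on the way the trace is preserved.
  obtain ⟨n, ⟨hns, hn⟩, hmax⟩ := Int.exists_greatest_of_bdd
    (P := fun n => n ≤ s ∧ Cross ω k n) ⟨s, fun z hz => hz.1⟩
    (by simpa using exists_cross_le ω k s)
  have hfree : ∀ i, n < i → i ≤ s + 1 → ¬ Cross ω k i := by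
    intro i h0 h1 hc
    rcases h1.lt_or_eq with h | h
    · exact absurd (hmax i ⟨by linarith, hc⟩) (by linarith)
    · exact hs (h ▸ hc)
  have key : ∀ i, n ≤ i → i ≤ s → (fibTransfer V ω E i (Nat.fib k)).trace = traceSeq V E k := by
    intro i hi
    induction i, hi using Int.leInduction with
    | base =>
      intro _
      rw [← trace_fibTransfer_zero V E hk]
      congr 1
      refine transfer_congr (fun i h0 h1 => ?_)
      have e : (Nat.fib (k + 2) : ℤ) = Nat.fib k + Nat.fib (k + 1) := by
        exact_mod_cast Nat.fib_add_two
      have e1 : (2 : ℤ) ≤ Nat.fib (k + 1) := by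
        exact_mod_cast (Nat.fib_mono (show 3 ≤ k + 1 by omega) : Nat.fib 3 ≤ _)
      simp only [zero_add]
      rw [hn.potential_add V h0 (by linarith)]
    | succ i hi ih =>
      intro his
      rw [← ih (by linarith)]
      refine trace_transfer_shift ?_
      show E - potential V ω (i + 1 + Nat.fib k) = E - potential V ω (i + 1)
      rw [potential_congr_of_not_cross V (hfree (i + 1) (by linarith) (by linarith))
        (hfree (i + 1 + 1) (by linarith) (by linarith))]
  exact key s hns le_rfl

/-! ### Approximate eigenvectors -/

theorem isSelfAdjoint_hamiltonian (V ω : ℝ) : IsSelfAdjoint (hamiltonian V ω) := by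
  rw [ContinuousLinearMap.isSelfAdjoint_iff_isSymmetric]
  intro f g
  change inner ℂ (hamiltonian V ω f) g = inner ℂ f (hamiltonian V ω g)
  have h1 : inner ℂ (permOp (Equiv.addRight 1) f) g =
      inner ℂ f (permOp (Equiv.subRight 1) g) := by
    rw [lp.inner_eq_tsum, lp.inner_eq_tsum,
      ← (Equiv.addRight (1 : ℤ)).tsum_eq (fun i => inner ℂ (f i) (permOp (Equiv.subRight 1) g i))]
    refine tsum_congr fun i => ?_
    change inner ℂ (f (i + 1)) (g i) = inner ℂ (f (i + 1)) (g (i + 1 - 1))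
    rw [add_sub_cancel_right]
  have h2 : inner ℂ (permOp (Equiv.subRight 1) f) g =
      inner ℂ f (permOp (Equiv.addRight 1) g) := by
    rw [lp.inner_eq_tsum, lp.inner_eq_tsum,
      ← (Equiv.subRight (1 : ℤ)).tsum_eq (fun i => inner ℂ (f i) (permOp (Equiv.addRight 1) g i))]
    refine tsum_congr fun i => ?_
    change inner ℂ (f (i - 1)) (g i) = inner ℂ (f (i - 1)) (g (i - 1 + 1))
    rw [sub_add_cancel]
  have h3 : inner ℂ (potOp V ω f) g = inner ℂ f (potOp V ω g) := by
    rw [lp.inner_eq_tsum, lp.inner_eq_tsum]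
    refine tsum_congr fun i => ?_
    change inner ℂ ((potential V ω i : ℂ) * f i) (g i) =
      inner ℂ (f i) ((potential V ω i : ℂ) * g i)
    simp; ring
  simp only [hamiltonian, add_apply, inner_add_left, inner_add_right, h1, h2,
    h3]
  ring

/-- A self-adjoint operator that is bounded below is invertible. -/
theorem isUnit_of_isSelfAdjoint_of_bound {H : Type*} [NormedAddCommGroup H]
    [InnerProductSpace ℂ H] [CompleteSpace H] {T : H →L[ℂ] H} (hT : IsSelfAdjoint T) {c : ℝ}
    (hc : 0 < c) (h : ∀ x, c * ‖x‖ ≤ ‖T x‖) : IsUnit T := by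
  have hanti : AntilipschitzWith (Real.toNNReal c⁻¹) T :=
    AddMonoidHomClass.antilipschitz_of_bound T fun x => by
      rw [Real.coe_toNNReal _ (by positivity), ← div_eq_inv_mul, le_div_iff₀ hc, mul_comm]
      exact h x
  rw [ContinuousLinearMap.isUnit_iff_bijective,
    ContinuousLinearMap.bijective_iff_dense_range_and_antilipschitz]
  refine ⟨?_, _, hanti⟩
  rw [Submodule.topologicalClosure_eq_top_iff, ContinuousLinearMap.orthogonal_range]
  rw [← ContinuousLinearMap.star_eq_adjoint, hT.star_eq]
  exact LinearMap.ker_eq_bot.2 hanti.injective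

theorem exists_approx_eigenvector {H : Type*} [NormedAddCommGroup H]
    [InnerProductSpace ℂ H] [CompleteSpace H] {T : H →L[ℂ] H} (hT : IsSelfAdjoint T) {E : ℝ}
    (hE : (E : ℂ) ∈ spectrum ℂ T) {δ : ℝ} (hδ : 0 < δ) :
    ∃ x, ‖T x - (E : ℂ) • x‖ < δ * ‖x‖ := by
  by_contra hc
  push Not at hc
  refine hE (isUnit_of_isSelfAdjoint_of_bound (c := δ) ?_ hδ fun x => ?_)
  · refine IsSelfAdjoint.sub ?_ hT
    rw [IsSelfAdjoint, ← algebraMap_star_comm]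
    simp
  · rw [sub_apply, norm_sub_rev, Algebra.algebraMap_eq_smul_one]
    exact hc x

theorem norm_sq_ellTwo (f : ellTwo) : HasSum (fun n => ‖f n‖ ^ 2) (‖f‖ ^ 2) := by
  have h2 : 0 < (2 : ℝ≥0∞).toReal := by norm_num
  simpa using lp.hasSum_norm h2 f

/-- Energies in the spectrum have finitely supported approximate eigenfunctions. -/
theorem exists_finite_approx {V ω E : ℝ} (hE : (E : ℂ) ∈ spectrum ℂ (hamiltonian V ω)) {δ : ℝ}
    (hδ : 0 < δ) : ∃ (R : ℕ) (φ : ℤ → ℂ), (∀ n, φ n ≠ 0 → |n| ≤ R) ∧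
      ∀ S T : Finset ℤ, (∀ n, φ n ≠ 0 → n ∈ T) →
        ∑ n ∈ S, ‖diffExpr V ω φ n - E * φ n‖ ^ 2 < δ ^ 2 * ∑ n ∈ T, ‖φ n‖ ^ 2 := by
  obtain ⟨f, hf⟩ := exists_approx_eigenvector (isSelfAdjoint_hamiltonian V ω) hE hδ
  have hs := lp.hasSum_single (p := 2) (by norm_num) f
  -- The strict inequality is an open condition, hence survives truncation of `f` to a large finite
  -- set.
  have hcont : Continuous fun g : ellTwo =>
      δ * ‖g‖ - ‖hamiltonian V ω g - (E : ℂ) • g‖ := by fun_prop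
  have hev := (hcont.tendsto f).comp hs
  have hpos : 0 < δ * ‖f‖ - ‖hamiltonian V ω f - (E : ℂ) • f‖ := by linarith
  obtain ⟨A, hA⟩ := (hev.eventually (lt_mem_nhds hpos)).exists
  set g : ellTwo := ∑ i ∈ A, lp.single 2 i (f i) with hg
  have hA' : ‖hamiltonian V ω g - (E : ℂ) • g‖ < δ * ‖g‖ := by
    have : 0 < δ * ‖g‖ - ‖hamiltonian V ω g - (E : ℂ) • g‖ := hA
    linarith
  have hsupp : ∀ n, g n ≠ 0 → n ∈ A := by
    intro n hn
    by_contra hnA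
    apply hn
    rw [hg, lp.coeFn_sum, Finset.sum_apply]
    refine Finset.sum_eq_zero fun i hi => ?_
    rw [lp.single_apply, Pi.single_eq_of_ne]
    rintro rfl
    exact hnA hi
  refine ⟨∑ i ∈ A, i.natAbs, g, fun n hn => ?_, fun S T hT => ?_⟩
  · rw [Int.abs_eq_natAbs]
    exact_mod_cast Finset.single_le_sum (f := fun i : ℤ => i.natAbs) (fun _ _ => Nat.zero_le _)
      (hsupp n hn)
  · have h1 : ∑ n ∈ S, ‖diffExpr V ω g n - E * g n‖ ^ 2 ≤
        ‖hamiltonian V ω g - (E : ℂ) • g‖ ^ 2 := by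
      have := norm_sq_ellTwo (hamiltonian V ω g - (E : ℂ) • g)
      exact sum_le_hasSum S (fun _ _ => by positivity) this
    have h2 : ‖g‖ ^ 2 = ∑ n ∈ T, ‖g n‖ ^ 2 := by
      refine (norm_sq_ellTwo g).unique (hasSum_sum_of_ne_finset_zero fun n hn => ?_)
      by_contra h
      exact hn (hT n fun h0 => h (by simp [h0]))
    rw [← h2, ← mul_pow]
    exact h1.trans_lt (by gcongr)

/-- In an eigenbasis, if every eigenvalue were at distance at least `|δ|` from `c`, Parseval would
contradict the hypothesis. -/
theorem exists_eigenvector_near {H : Type*} [NormedAddCommGroup H] [InnerProductSpace ℂ H]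
    [FiniteDimensional ℂ H] {T : H →ₗ[ℂ] H} (hT : T.IsSymmetric) {c δ : ℝ} {x : H}
    (hx : ‖T x - (c : ℂ) • x‖ ^ 2 < δ ^ 2 * ‖x‖ ^ 2) :
    ∃ l : ℝ, |l - c| < |δ| ∧ ∃ v, v ≠ 0 ∧ T v = (l : ℂ) • v := by
  set b := hT.eigenvectorBasis (rfl : Module.finrank ℂ H = _)
  by_contra hc
  push Not at hc
  have key : ∀ i, δ ^ 2 * ‖inner ℂ (b i) x‖ ^ 2 ≤ ‖inner ℂ (b i) (T x - (c : ℂ) • x)‖ ^ 2 := by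
    intro i
    have h1 : inner ℂ (b i) (T x - (c : ℂ) • x) =
        ((hT.eigenvalues rfl i : ℂ) - c) * inner ℂ (b i) x := by
      rw [inner_sub_right, inner_smul_right, ← hT, hT.apply_eigenvectorBasis, inner_smul_left]
      simp; ring
    have h2 : |δ| ≤ |hT.eigenvalues rfl i - c| := by
      by_contra h
      push Not at h
      exact hc _ h (b i) (b.orthonormal.ne_zero i) (hT.apply_eigenvectorBasis rfl i)
    rw [h1, norm_mul, mul_pow, ← Complex.ofReal_sub, Complex.norm_real, Real.norm_eq_abs, sq_abs]
    have := sq_le_sq.2 h2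
    gcongr
  have h3 := Finset.sum_le_sum fun i (_ : i ∈ Finset.univ) => key i
  rw [← Finset.mul_sum, b.sum_sq_norm_inner_right, b.sum_sq_norm_inner_right] at h3
  linarith

/-! ### Periodic approximants -/

/-- The periodic Schrödinger operator with potential `w`. -/
noncomputable def periodicOp {p : ℕ} [NeZero p] (w : ZMod p → ℝ) :
    EuclideanSpace ℂ (ZMod p) →ₗ[ℂ] EuclideanSpace ℂ (ZMod p) where
  toFun f := WithLp.toLp 2 fun i => f (i + 1) + f (i - 1) + w i * f i
  map_add' f g := by ext i; simp; ring
  map_smul' a f := by ext i; simp; ring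

theorem periodicOp_isSymmetric {p : ℕ} [NeZero p] (w : ZMod p → ℝ) :
    (periodicOp w).IsSymmetric := by
  intro f g
  simp only [PiLp.inner_apply, periodicOp, LinearMap.coe_mk, AddHom.coe_mk]
  simp only [RCLike.inner_apply, map_add, map_mul, Complex.conj_ofReal, mul_add, add_mul,
    Finset.sum_add_distrib]
  have h1 : ∑ x, g x * (starRingEnd ℂ) (f (x + 1)) = ∑ x, g (x - 1) * (starRingEnd ℂ) (f x) :=
    Fintype.sum_equiv (Equiv.addRight (1 : ZMod p)) _ _ fun x => by simp
  have h2 : ∑ x, g x * (starRingEnd ℂ) (f (x - 1)) = ∑ x, g (x + 1) * (starRingEnd ℂ) (f x) :=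
    Fintype.sum_equiv (Equiv.subRight (1 : ZMod p)) _ _ fun x => by simp
  rw [h1, h2]
  congr 1
  · ring
  · exact Finset.sum_congr rfl fun x _ => by ring

/-- An eigenvalue of the periodic operator is an energy with trace two over the period. -/
theorem trace_eq_two_of_periodic {p : ℕ} [NeZero p] {w : ZMod p → ℝ} {l : ℝ}
    {v : EuclideanSpace ℂ (ZMod p)} (hv : v ≠ 0) (h : periodicOp w v = (l : ℂ) • v) (s : ℤ) :
    (transfer (fun n => l - w n) s p).trace = 2 := by
  set u : ℤ → ℂ := fun n => v (n : ZMod p) with hu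
  have hrec : ∀ n : ℤ, u (n + 1) = ((l - w n : ℝ) : ℂ) * u n - u (n - 1) := by
    intro n
    have := congrArg (fun f : EuclideanSpace ℂ (ZMod p) => f (n : ZMod p)) h
    simp only [periodicOp, LinearMap.coe_mk, AddHom.coe_mk, PiLp.smul_apply, smul_eq_mul] at this
    simp only [hu]
    push_cast
    linear_combination this
  obtain ⟨h1, h2⟩ := solution_transfer (d := fun n => l - w n) hrec s p
  have e1 : u (s + p + 1) = u (s + 1) := by simp [hu]
  have e2 : u (s + p) = u s := by simp [hu]
  rw [e1] at h1
  rw [e2] at h2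
  have hne : ¬ (u (s + 1) = 0 ∧ u s = 0) := by
    rintro ⟨z1, z2⟩
    apply hv
    ext i
    have hs := (solution_transfer (d := fun n => l - w n) hrec s (i - s : ZMod p).val).2
    rw [z1, z2] at hs
    simpa [hu] using hs
  have hd := det_transfer (fun n => l - w n) s p
  rw [Matrix.det_fin_two] at hd
  rw [Matrix.trace_fin_two]
  set a := transfer (fun n : ℤ => l - w n) s p 0 0
  set b := transfer (fun n : ℤ => l - w n) s p 0 1
  set c := transfer (fun n : ℤ => l - w n) s p 1 0
  set d := transfer (fun n : ℤ => l - w n) s p 1 1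
  have hd' : (a : ℂ) * d - b * c = 1 := by exact_mod_cast hd
  -- The transfer matrix `M` fixes `(u(s+1), u(s))`, hence so does `M⁻¹`, and `M + M⁻¹ = tr M` as
  -- the determinant is one.
  have k1 : ((a : ℂ) + d - 2) * u (s + 1) = 0 := by
    linear_combination (d - 1 : ℂ) * h1 - b * h2 + u (s + 1) * hd'
  have k2 : ((a : ℂ) + d - 2) * u s = 0 := by
    linear_combination (a - 1 : ℂ) * h2 - c * h1 + u s * hd'
  have k3 : (a : ℂ) + d - 2 = 0 := by
    by_contra hk
    exact hne ⟨(mul_eq_zero.1 k1).resolve_left hk, (mul_eq_zero.1 k2).resolve_left hk⟩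
  have : a + d - 2 = 0 := by exact_mod_cast k3
  linarith

/-- Energies in the spectrum are limits of energies of periodic approximants. -/
theorem exists_traceSeq_eq_two {V E : ℝ} (hE : E ∈ Sigma V) {δ : ℝ} (hδ : 0 < δ) (K : ℕ) :
    ∃ k, K ≤ k ∧ ∃ E', |E' - E| < δ ∧ traceSeq V E' k = 2 := by
  obtain ⟨ω, hω⟩ := hE
  obtain ⟨R, φ, hR, hφ⟩ := exists_finite_approx hω hδ
  set k := K + 2 * R + 20 with hk
  have hfib : 2 * R + 20 ≤ Nat.fib k :=
    le_trans (by omega) (Nat.le_fib_self (show 5 ≤ k by omega))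
  -- Of two neighbouring starting points one avoids a crossing, so that the trace over the period is
  -- `traceSeq`. The margin around the support of `φ` makes wrapping around the circle harmless.
  obtain ⟨s, hs1, hs2, hs⟩ : ∃ s : ℤ, -R - 4 ≤ s ∧ s ≤ -R - 3 ∧ ¬ Cross ω k (s + 1) := by
    by_cases h : Cross ω k (-R - 4 + 1)
    · refine ⟨-R - 3, by linarith, le_rfl, ?_⟩
      have := h.not_succ (by omega)
      rwa [show -(R : ℤ) - 3 + 1 = -R - 4 + 1 + 1 by ring]
    · exact ⟨-R - 4, le_rfl, by linarith, h⟩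
  set p := Nat.fib k with hp
  have : NeZero p := ⟨by omega⟩
  have hpz : (2 : ℤ) * R + 20 ≤ p := by exact_mod_cast hfib
  set rep : ZMod p → ℤ := fun i => s + 1 + (i - (s + 1 : ℤ) : ZMod p).val with hrep
  have hrep1 : ∀ i, s + 1 ≤ rep i ∧ rep i ≤ s + p := by
    intro i
    have := ZMod.val_lt (i - (s + 1 : ℤ) : ZMod p)
    constructor <;> simp only [hrep] <;> omega
  have hrep2 : ∀ i, ((rep i : ℤ) : ZMod p) = i := by
    intro i; simp [hrep]
  have hrep3 : ∀ n : ℤ, s + 1 ≤ n → n ≤ s + p → rep (n : ZMod p) = n := by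
    intro n h1 h2
    have h3 : ((rep (n : ZMod p) : ℤ) : ZMod p) = (n : ZMod p) := hrep2 _
    rw [ZMod.intCast_eq_intCast_iff] at h3
    have h4 := hrep1 (n : ZMod p)
    obtain ⟨c, hc⟩ := h3.symm.dvd
    have : c = 0 := by
      by_contra hne
      rcases lt_or_gt_of_ne hne with h | h <;> nlinarith
    rw [this] at hc
    linarith
  have hφ0 : ∀ n : ℤ, s ≤ n → n ≤ s + p + 1 → φ (rep (n : ZMod p)) = φ n := by
    intro n h1 h2
    have hz : ∀ m : ℤ, m ≤ s + 1 ∨ s + p ≤ m → φ m = 0 := by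
      intro m hm
      by_contra hne
      have := abs_le.1 (hR m hne)
      rcases hm with hm | hm <;> linarith
    rcases h1.lt_or_eq with h1 | h1
    · rcases h2.lt_or_eq with h2 | h2
      · rw [hrep3 n (by linarith) (by linarith)]
      · rw [hz n (by right; linarith), h2]
        have : ((s + p + 1 : ℤ) : ZMod p) = ((s + 1 : ℤ) : ZMod p) := by push_cast; simp
        rw [this, hrep3 (s + 1) le_rfl (by linarith)]
        exact hz _ (by left; linarith)
    · rw [hz n (by left; linarith), ← h1]
      have : ((s : ℤ) : ZMod p) = ((s + p : ℤ) : ZMod p) := by push_cast; simp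
      rw [this, hrep3 (s + p) (by linarith) le_rfl]
      exact hz _ (by right; linarith)
  set w : ZMod p → ℝ := fun i => potential V ω (rep i) with hw
  set x : EuclideanSpace ℂ (ZMod p) := WithLp.toLp 2 fun i => φ (rep i) with hx
  have hsum : ∀ F : ℤ → ℝ, ∑ i, F (rep i) = ∑ n ∈ Finset.Icc (s + 1) (s + p), F n := by
    intro F
    refine Finset.sum_nbij' rep (fun n => (n : ZMod p)) ?_ ?_ ?_ ?_ ?_
    · intro i _; exact Finset.mem_Icc.2 (hrep1 i)
    · intro n _; exact Finset.mem_univ _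
    · intro i _; exact hrep2 i
    · intro n hn; rw [Finset.mem_Icc] at hn; exact hrep3 n hn.1 hn.2
    · intro i _; rfl
  have hnear : ‖periodicOp w x - (E : ℂ) • x‖ ^ 2 < δ ^ 2 * ‖x‖ ^ 2 := by
    rw [EuclideanSpace.norm_sq_eq, EuclideanSpace.norm_sq_eq]
    have h1 : ∀ i, (periodicOp w x - (E : ℂ) • x) i =
        diffExpr V ω φ (rep i) - E * φ (rep i) := by
      intro i
      have h2 := hrep1 i
      have a1 : φ (rep (i + 1)) = φ (rep i + 1) := by
        rw [← hφ0 (rep i + 1) (by linarith) (by linarith)]; push_cast; rw [hrep2]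
      have a2 : φ (rep (i - 1)) = φ (rep i - 1) := by
        rw [← hφ0 (rep i - 1) (by linarith) (by linarith)]; push_cast; rw [hrep2]
      change φ (rep (i + 1)) + φ (rep (i - 1)) + (w i : ℂ) * φ (rep i) - E * φ (rep i) = _
      rw [a1, a2]; rfl
    simp only [h1]
    rw [hsum (fun n => ‖diffExpr V ω φ n - E * φ n‖ ^ 2)]
    change _ < δ ^ 2 * ∑ i, (fun n => ‖φ n‖ ^ 2) (rep i)
    rw [hsum (fun n => ‖φ n‖ ^ 2)]
    refine hφ _ _ fun n hn => ?_
    have := abs_le.1 (hR n hn)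
    rw [Finset.mem_Icc]
    constructor <;> linarith
  obtain ⟨l, hl, v, hv, hev⟩ := exists_eigenvector_near (periodicOp_isSymmetric w) hnear
  refine ⟨k, by omega, l, by rwa [abs_of_pos hδ] at hl, ?_⟩
  rw [← trace_fibTransfer V ω l (show 2 ≤ k by omega) hs, ← hp,
    ← trace_eq_two_of_periodic hv hev s]
  congr 1
  refine transfer_congr fun i h1 h2 => ?_
  simp only [hw]
  rw [hrep3 (s + i) (by linarith) (by linarith)]

/-! ### The trace bound -/

theorem traceSeq_add_three (V E : ℝ) (n : ℕ) : traceSeq V E (n + 3) =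
    traceSeq V E (n + 2) * traceSeq V E (n + 1) - traceSeq V E n := rfl

theorem traceSeq_invariant (V E : ℝ) (n : ℕ) :
    traceSeq V E (n + 2) ^ 2 + traceSeq V E (n + 1) ^ 2 + traceSeq V E n ^ 2 -
      traceSeq V E (n + 2) * traceSeq V E (n + 1) * traceSeq V E n = 4 + V ^ 2 := by
  induction n with
  | zero => simp only [traceSeq]; ring
  | succ n ih =>
    rw [show n + 1 + 2 = n + 3 by ring, show n + 1 + 1 = n + 2 by ring, traceSeq_add_three]
    linear_combination ih

theorem continuous_traceSeq (V : ℝ) (n : ℕ) : Continuous fun E => traceSeq V E n := by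
  have h : Continuous (fun E => traceSeq V E n) ∧ Continuous (fun E => traceSeq V E (n + 1)) ∧
      Continuous (fun E => traceSeq V E (n + 2)) := by
    induction n with
    | zero => simp only [traceSeq]; exact ⟨by fun_prop, by fun_prop, by fun_prop⟩
    | succ n ih =>
      obtain ⟨a, b, c⟩ := ih
      refine ⟨b, c, ?_⟩
      simp only [show n + 1 + 2 = n + 3 by ring, traceSeq_add_three]
      fun_prop
  exact h.1

/-- The escape criterion for the trace map. -/
theorem two_lt_abs_traceSeq {V E : ℝ} {N : ℕ} (h1 : 2 < |traceSeq V E (N + 1)|)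
    (h2 : 2 < |traceSeq V E (N + 2)|)
    (h0 : |traceSeq V E N| < max |traceSeq V E (N + 1)| |traceSeq V E (N + 2)|) (k : ℕ)
    (hk : N + 1 ≤ k) : 2 < |traceSeq V E k| := by
  have key : ∀ j : ℕ, 2 < |traceSeq V E (N + j + 1)| ∧ 2 < |traceSeq V E (N + j + 2)| ∧
      |traceSeq V E (N + j)| < max |traceSeq V E (N + j + 1)| |traceSeq V E (N + j + 2)| := by
    intro j
    induction j with
    | zero => exact ⟨h1, h2, h0⟩
    | succ j ih =>
      obtain ⟨a, b, c⟩ := ih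
      rw [show N + (j + 1) + 1 = N + j + 2 by ring, show N + (j + 1) + 2 = N + j + 3 by ring,
        show N + (j + 1) = N + j + 1 by ring, traceSeq_add_three]
      set x := traceSeq V E (N + j)
      set y := traceSeq V E (N + j + 1)
      set z := traceSeq V E (N + j + 2)
      have h3 : |z| * |y| - |x| ≤ |z * y - x| := by
        rw [← abs_mul]; exact abs_sub_abs_le_abs_sub _ _
      -- Both moduli exceed 2, so `|z||y|` is more than twice their maximum, while `|x|` is less
      -- than that maximum.
      have h4 : max |y| |z| < |z * y - x| := by
        rcases max_cases |y| |z| with ⟨h, _⟩ | ⟨h, _⟩ <;> rw [h] at c ⊢ <;> nlinarith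
      exact ⟨b, b.trans ((le_max_right _ _).trans_lt h4),
        lt_max_of_lt_right ((le_max_left _ _).trans_lt h4)⟩
  obtain ⟨j, rfl⟩ := Nat.exists_eq_add_of_le hk
  have := (key j).1
  rwa [show N + j + 1 = N + 1 + j by ring] at this

/-- On the spectrum no two consecutive traces exceed two. -/
theorem not_two_lt_abs_traceSeq {V E : ℝ} (hE : E ∈ Sigma V) (n : ℕ) :
    ¬ (2 < |traceSeq V E n| ∧ 2 < |traceSeq V E (n + 1)|) := by
  induction n with
  | zero => simp [traceSeq]
  | succ N ih =>
    rintro ⟨h1, h2⟩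
    have h0 : |traceSeq V E N| ≤ 2 := by
      by_contra h
      exact ih ⟨by linarith, h1⟩
    have h0' : |traceSeq V E N| < max |traceSeq V E (N + 1)| |traceSeq V E (N + 2)| :=
      lt_max_of_lt_left (by linarith)
    -- The escape condition is open in the energy, but some nearby energy has a later trace equal to
    -- 2.
    have c := fun j => (continuous_traceSeq V j).abs
    have e1 := (c (N + 1)).tendsto E |>.eventually (lt_mem_nhds h1)
    have e2 := (c (N + 2)).tendsto E |>.eventually (lt_mem_nhds h2)
    have e3 := ((c N).tendsto E).eventually_lt (((c (N + 1)).max (c (N + 2))).tendsto E) h0'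
    obtain ⟨δ, hδ, hball⟩ := Metric.eventually_nhds_iff.1 (e1.and (e2.and e3))
    obtain ⟨k, hk, E', hE', h⟩ := exists_traceSeq_eq_two hE hδ (N + 1)
    obtain ⟨f1, f2, f3⟩ := hball (y := E') (by rwa [Real.dist_eq])
    have := two_lt_abs_traceSeq f1 f2 f3 k hk
    rw [h] at this
    norm_num at this

/-- A trace `y` larger than `2 + V` has both neighbours `x`, `z` at most 2 in modulus. Completing
the square in the invariant gives `(2|y| - |xz|)² ≤ (4 - x²)(4 - z²) + 4V² ≤ (4 - |xz| + 2V)²`, a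
contradiction. -/
theorem abs_traceSeq_le {V E : ℝ} (hV : 0 < V) (hE : E ∈ Sigma V) (n : ℕ) :
    |traceSeq V E n| ≤ 2 + V := by
  by_contra hc
  push Not at hc
  have hn : n ≠ 0 := by
    rintro rfl
    simp [traceSeq] at hc
    linarith
  obtain ⟨m, rfl⟩ := Nat.exists_eq_succ_of_ne_zero hn
  have h1 : |traceSeq V E m| ≤ 2 := by
    by_contra h
    exact not_two_lt_abs_traceSeq hE m ⟨by linarith, by linarith⟩
  have h2 : |traceSeq V E (m + 2)| ≤ 2 := by
    by_contra h
    exact not_two_lt_abs_traceSeq hE (m + 1) ⟨by linarith, by linarith⟩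
  have hinv := traceSeq_invariant V E m
  rw [Nat.succ_eq_add_one] at hc
  set x := traceSeq V E m
  set y := traceSeq V E (m + 1)
  set z := traceSeq V E (m + 2)
  set p := |x| with hp
  set q := |z| with hq
  have hp0 : 0 ≤ p := abs_nonneg _
  have hq0 : 0 ≤ q := abs_nonneg _
  have hxy : z * y * x ≤ q * |y| * p := by
    rw [hq, hp, ← abs_mul, ← abs_mul]; exact le_abs_self _
  have hx2 : x ^ 2 = p ^ 2 := (sq_abs x).symm
  have hz2 : z ^ 2 = q ^ 2 := (sq_abs z).symm
  have hy2 : y ^ 2 = |y| ^ 2 := (sq_abs y).symm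
  rw [hx2, hz2, hy2] at hinv
  set r := |y|
  have hpq : p * q ≤ 4 := by nlinarith
  have h3 : (2 * r - p * q) ^ 2 ≤ (4 - p ^ 2) * (4 - q ^ 2) + 4 * V ^ 2 := by nlinarith
  have h4 : (4 - p ^ 2) * (4 - q ^ 2) ≤ (4 - p * q) ^ 2 := by nlinarith [sq_nonneg (p - q)]
  have h5 : 4 - p * q + 2 * V < 2 * r - p * q := by linarith
  nlinarith [mul_nonneg (sub_nonneg.2 hpq) hV.le]

/-! ### Growth of transfer matrices -/

theorem potential_eq_or (V ω : ℝ) (n : ℤ) : potential V ω n = V ∨ potential V ω n = 0 := by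
  unfold potential
  split_ifs <;> simp

theorem abs_sub_potential_le {V E : ℝ} (hV : 0 < V) (hE : E ∈ Sigma V) (ω : ℝ) (n : ℤ) :
    |E - potential V ω n| ≤ 2 + V := by
  rcases potential_eq_or V ω n with h | h <;> rw [h]
  · exact abs_traceSeq_le hV hE 2
  · rw [sub_zero]; exact abs_traceSeq_le hV hE 1

theorem mnorm_fibTransfer_le {V E : ℝ} (hV : 0 < V) (hE : E ∈ Sigma V) (ω : ℝ) (s : ℤ) (n : ℕ) :
    mnorm (fibTransfer V ω E s n) ≤ 2 * (4 + V) ^ n := by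
  induction n with
  | zero => simp [fibTransfer, transfer, mnorm_one]
  | succ n ih =>
    refine (mnorm_mul_le _ _).trans ?_
    rw [mnorm_stepMat]
    have h1 := abs_sub_potential_le hV hE ω (s + n + 1)
    have h2 : |E - potential V ω (s + n + 1)| + 2 ≤ 4 + V := by linarith
    calc _ ≤ (4 + V) * (2 * (4 + V) ^ n) :=
          mul_le_mul h2 ih (mnorm_nonneg _) (by linarith)
      _ = _ := by ring

/-- The block of length `fib k` after site `a` occurs twice in a row; Cayley-Hamilton reduces its
square. -/
theorem fibTransfer_zero_square {V E : ℝ} {k a : ℕ} (hk : 2 ≤ k)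
    (ha : a + Nat.fib k + 1 < Nat.fib (k + 1)) :
    fibTransfer V 0 E 0 (a + Nat.fib k + Nat.fib k) =
      traceSeq V E k • fibTransfer V 0 E 0 (a + Nat.fib k) - fibTransfer V 0 E 0 a := by
  have ha' : (a : ℤ) + Nat.fib k + 1 < Nat.fib (k + 1) := by exact_mod_cast ha
  have hnc : ¬ Cross 0 k ((a : ℤ) + 1) := by
    intro h
    have := Int.natCast_nonneg a
    have := Int.natCast_nonneg (Nat.fib k)
    rcases h.zero_ge with h | h | h <;> linarith
  have htr := trace_fibTransfer V 0 E hk hnc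
  unfold fibTransfer at *
  have hsq : transfer (fun n => E - potential V 0 n) (a + Nat.fib k) (Nat.fib k) =
      transfer (fun n => E - potential V 0 n) a (Nat.fib k) := by
    refine transfer_congr fun i h0 h1 => ?_
    rw [show (a : ℤ) + Nat.fib k + i = a + i + Nat.fib k by ring,
      potential_zero_add_fib V k (by linarith [Int.natCast_nonneg a]) (by linarith)]
  have e := transfer_add (fun n => E - potential V 0 n) 0 (a + Nat.fib k) (Nat.fib k)
  have e1 := transfer_add (fun n => E - potential V 0 n) 0 a (Nat.fib k)
  simp only [zero_add, Nat.cast_add] at e e1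
  rw [e, e1, hsq, ← Matrix.mul_assoc, mul_self_eq_of_det_one (det_transfer _ _ _), htr,
    Matrix.sub_mul, Matrix.smul_mul, Matrix.one_mul]

theorem fibTransfer_zero_overlap {V E : ℝ} {k a b : ℕ} (hk : 2 ≤ k) (hab : a + b = Nat.fib k)
    (ha : a + 1 < Nat.fib (k + 1)) :
    fibTransfer V 0 E 0 (a + b + a) =
      traceSeq V E k • fibTransfer V 0 E 0 a - (fibTransfer V 0 E a b).adjugate := by
  have ha' : (a : ℤ) + 1 < Nat.fib (k + 1) := by exact_mod_cast ha
  have htr := trace_fibTransfer_zero V E hk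
  unfold fibTransfer at *
  have hsq : transfer (fun n => E - potential V 0 n) (Nat.fib k) a =
      transfer (fun n => E - potential V 0 n) 0 a := by
    refine transfer_congr fun i h0 h1 => ?_
    rw [zero_add, add_comm, potential_zero_add_fib V k h0 (by linarith)]
  have e := transfer_add (fun n => E - potential V 0 n) 0 (a + b) a
  have e1 := transfer_add (fun n => E - potential V 0 n) 0 a b
  rw [zero_add] at e e1
  rw [← hab, e1] at htr
  rw [e, e1, hab, hsq, ← Matrix.mul_assoc, mul_mul_self_eq (det_transfer _ _ _)
    (det_transfer _ _ _), htr]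

/-- Strong induction on the Fibonacci level, each level costing `(2 + V) + 1`. The margin of two
sites keeps all windows inside the range where repetition and palindromy hold. -/
theorem mnorm_fibTransfer_zero_le {V E : ℝ} (hV : 0 < V) (hE : E ∈ Sigma V) (n : ℕ) :
    ∀ N : ℕ, N + 2 ≤ Nat.fib n →
      mnorm (fibTransfer V 0 E 0 N) ≤ 2 * (4 + V) ^ 6 * (3 + V) ^ n := by
  induction n using Nat.strong_induction_on with
  | _ n ih =>
  intro N hN
  set K := 2 * (4 + V) ^ 6 with hK
  have hK0 : 0 < K := by positivity
  have hK1 : 4 + V ≤ K := by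
    have : (4 + V) ^ 1 ≤ (4 + V) ^ 6 := pow_le_pow_right₀ (by linarith) (by norm_num)
    linarith
  rcases Nat.lt_or_ge n 7 with hn | hn
  · have h6 : N ≤ 6 := by
      have : Nat.fib n ≤ Nat.fib 6 := Nat.fib_mono (by omega)
      have h : Nat.fib 6 = 8 := by decide
      omega
    calc _ ≤ 2 * (4 + V) ^ N := mnorm_fibTransfer_le hV hE 0 0 N
      _ ≤ K := by
        have : (4 + V) ^ N ≤ (4 + V) ^ 6 := pow_le_pow_right₀ (by linarith) h6
        linarith
      _ ≤ K * (3 + V) ^ n := le_mul_of_one_le_right hK0.le (one_le_pow₀ (by linarith))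
  obtain ⟨q, rfl⟩ : ∃ q, n = q + 3 := ⟨n - 3, by omega⟩
  have hq : 4 ≤ q := by omega
  have f2 : Nat.fib (q + 2) = Nat.fib q + Nat.fib (q + 1) := Nat.fib_add_two
  have f3 : Nat.fib (q + 3) = Nat.fib (q + 1) + Nat.fib (q + 2) := Nat.fib_add_two
  have f1 : Nat.fib q < Nat.fib (q + 1) := Nat.fib_lt_fib_succ (by omega)
  have f12 : Nat.fib (q + 1) < Nat.fib (q + 2) := Nat.fib_lt_fib_succ (by omega)
  obtain ⟨q', rfl⟩ : ∃ q', q = q' + 1 := ⟨q - 1, by omega⟩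
  have f0 : Nat.fib (q' + 1 + 1) = Nat.fib q' + Nat.fib (q' + 1) := Nat.fib_add_two
  have f01 : Nat.fib q' < Nat.fib (q' + 1) := Nat.fib_lt_fib_succ (by omega)
  set q := q' + 1 with hqq
  have ht := abs_traceSeq_le hV hE (q + 1)
  have hl : (0 : ℝ) < (3 + V) ^ q := by positivity
  have p1 : (3 + V) ^ (q + 1) = (3 + V) ^ q * (3 + V) := pow_succ _ _
  have p2 : (3 + V) ^ (q + 2) = (3 + V) ^ q * (3 + V) ^ 2 := pow_add _ _ _
  have p3 : (3 + V) ^ (q + 3) = (3 + V) ^ q * (3 + V) ^ 3 := pow_add _ _ _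
  rcases Nat.lt_or_ge (Nat.fib (q + 2)) (N + 2) with h | h
  swap
  · refine (ih (q + 2) (by omega) N h).trans ?_
    gcongr
    · linarith
    · omega
  rcases Nat.lt_or_ge N (2 * Nat.fib (q + 1)) with h2 | h2
  · obtain ⟨a, ha⟩ : ∃ a, N = Nat.fib (q + 1) + a := ⟨N - Nat.fib (q + 1), by omega⟩
    obtain ⟨b, hb⟩ : ∃ b, a + b = Nat.fib (q + 1) := ⟨Nat.fib (q + 1) - a, by omega⟩
    have e := fibTransfer_zero_overlap (V := V) (E := E) (k := q + 1) (by omega) hb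
      (show a + 1 < Nat.fib (q + 2) by omega)
    rw [show a + b + a = N by omega] at e
    rw [e]
    refine (mnorm_smul_sub_le _ _ _).trans ?_
    rw [mnorm_adjugate]
    -- Palindromy misses the last two sites of the block, so `b` is shortened by two before
    -- reflecting; `b = 1` needs a direct estimate.
    rcases Nat.lt_or_ge b 2 with hb2 | hb2
    · have hA := ih (q + 2) (by omega) a (by omega)
      have hB : mnorm (fibTransfer V 0 E a b) ≤ 4 + V := by
        have : b = 1 := by omega
        rw [this, fibTransfer, transfer_one, mnorm_stepMat]
        linarith [abs_sub_potential_le hV hE 0 (a + 1)]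
      calc _ ≤ (2 + V) * (K * (3 + V) ^ (q + 2)) + K * (3 + V) ^ (q + 2) := by
            refine add_le_add (mul_le_mul ht hA (mnorm_nonneg _) (by linarith)) ?_
            exact (hB.trans hK1).trans
              (le_mul_of_one_le_right hK0.le (one_le_pow₀ (by linarith)))
        _ = K * (3 + V) ^ (q + 3) := by ring
    · have hA := ih (q + 1) (by omega) a (by omega)
      obtain ⟨c, rfl⟩ : ∃ c, b = c + 2 := ⟨b - 2, by omega⟩
      have hC := ih q (by omega) c (by omega)
      have hrev : mnorm (fibTransfer V 0 E a c) = mnorm (fibTransfer V 0 E 0 c) := by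
        refine mnorm_transfer_reverse fun i h0 h1 => ?_
        have hb' : (a : ℤ) + (c + 2) = Nat.fib (q + 1) := by exact_mod_cast hb
        rw [← potential_zero_fib_reflect V (q + 1) (i := 0 + c + 1 - i) (by linarith)
          (by linarith [Int.natCast_nonneg a])]
        congr 2
        linarith
      have hB : mnorm (fibTransfer V 0 E a (c + 2)) ≤ (4 + V) ^ 2 * (K * (3 + V) ^ q) := by
        have s1 : ∀ x : ℤ, mnorm (stepMat (E - potential V 0 x)) ≤ 4 + V := fun x => by
          rw [mnorm_stepMat]; linarith [abs_sub_potential_le hV hE 0 x]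
        rw [← hrev] at hC
        calc _ ≤ (4 + V) * ((4 + V) * (K * (3 + V) ^ q)) := by
              refine (mnorm_mul_le _ _).trans (mul_le_mul (s1 _) ?_ (mnorm_nonneg _) (by linarith))
              exact (mnorm_mul_le _ _).trans (mul_le_mul (s1 _) hC (mnorm_nonneg _) (by linarith))
          _ = _ := by ring
      calc _ ≤ (2 + V) * (K * (3 + V) ^ (q + 1)) + (4 + V) ^ 2 * (K * (3 + V) ^ q) :=
            add_le_add (mul_le_mul ht hA (mnorm_nonneg _) (by linarith)) hB
        _ = K * (3 + V) ^ q * ((2 + V) * (3 + V) + (4 + V) ^ 2) := by rw [p1]; ring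
        _ ≤ K * (3 + V) ^ q * (3 + V) ^ 3 := by
            refine mul_le_mul_of_nonneg_left ?_ (by positivity)
            nlinarith [mul_pos hV hV, mul_pos (mul_pos hV hV) hV]
        _ = _ := by rw [p3]; ring
  · obtain ⟨a, rfl⟩ : ∃ a, N = a + Nat.fib (q + 1) + Nat.fib (q + 1) :=
      ⟨N - 2 * Nat.fib (q + 1), by omega⟩
    rw [fibTransfer_zero_square (by omega) (show _ < Nat.fib (q + 2) by omega)]
    refine (mnorm_smul_sub_le _ _ _).trans ?_
    have hA := ih (q + 2) (by omega) (a + Nat.fib (q + 1)) (by omega)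
    have hB := ih (q + 2) (by omega) a (by omega)
    calc _ ≤ (2 + V) * (K * (3 + V) ^ (q + 2)) + K * (3 + V) ^ (q + 2) :=
          add_le_add (mul_le_mul ht hA (mnorm_nonneg _) (by linarith)) hB
      _ = K * (3 + V) ^ (q + 3) := by ring

/-- Reflection carries the sites up to `-2` to those from 1 on. The sites `-1` and `0` are not
covered and cost the factor with `(4 + V)^2`. -/
theorem mnorm_fibTransfer_neg_le {V E : ℝ} (hV : 0 < V) (hE : E ∈ Sigma V) {n j m : ℕ}
    (hj : j ≤ Nat.fib n) (hm : m ≤ j) (hm' : j ≤ m + 2) :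
    mnorm (fibTransfer V 0 E (-j) m) ≤
      2 * (4 + V) ^ 2 * (2 * (4 + V) ^ 6 * (3 + V) ^ n) := by
  have h1 : (1 : ℝ) ≤ 2 * (4 + V) ^ 6 * (3 + V) ^ n := by
    have a := one_le_pow₀ (show 1 ≤ 4 + V by linarith) (n := 6)
    have b := one_le_pow₀ (show 1 ≤ 3 + V by linarith) (n := n)
    nlinarith
  have h2 : ∀ (s : ℤ) (e : ℕ), e ≤ 2 → mnorm (fibTransfer V 0 E s e) ≤ 2 * (4 + V) ^ 2 := by
    intro s e he
    refine (mnorm_fibTransfer_le hV hE 0 s e).trans ?_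
    have : (4 + V) ^ e ≤ (4 + V) ^ 2 := pow_le_pow_right₀ (by linarith) he
    linarith
  rcases Nat.lt_or_ge j 2 with h | h
  · exact (h2 _ m (by omega)).trans (le_mul_of_one_le_right (by positivity) h1)
  · obtain ⟨c, rfl⟩ : ∃ c, j = c + 2 := ⟨j - 2, by omega⟩
    obtain ⟨e, rfl⟩ : ∃ e, m = c + e := ⟨m - c, by omega⟩
    unfold fibTransfer
    rw [transfer_add]
    refine (mnorm_mul_le _ _).trans
      (mul_le_mul (h2 _ e (by omega)) ?_ (mnorm_nonneg _) (by positivity))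
    refine le_trans (le_of_eq ?_) (mnorm_fibTransfer_zero_le hV hE n c hj)
    refine mnorm_transfer_reverse fun i h0 h1 => ?_
    rw [← potential_zero_reflect V (i := 0 + c + 1 - i) (by linarith)]
    congr 2
    push_cast; ring

/-- Polynomial bound for all transfer matrices, uniformly in the phase. -/
theorem exists_mnorm_fibTransfer_le {V : ℝ} (hV : 0 < V) : ∃ D, 0 < D ∧
    ∀ (ω E : ℝ), E ∈ Sigma V → ∀ n N : ℕ, N + 2 ≤ Nat.fib n →
      mnorm (fibTransfer V ω E 0 N) ≤ D * ((3 + V) ^ n) ^ 2 := by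
  refine ⟨2 * (4 + V) ^ 2 * (2 * (4 + V) ^ 6) ^ 2 * 2, by positivity, ?_⟩
  intro ω E hE n N hN
  obtain ⟨j, hj0, hj1, hj⟩ := exists_potential_eq_zero_phase ω N
  obtain ⟨j, rfl⟩ := Int.eq_ofNat_of_zero_le hj0
  have e : fibTransfer V ω E 0 N = fibTransfer V 0 E (-j) N := by
    refine transfer_congr fun i h0 h1 => ?_
    rw [zero_add, hj V i (by linarith) h1]
    congr 2; ring
  have hK1 : (1 : ℝ) ≤ 2 * (4 + V) ^ 6 * (3 + V) ^ n := by
    have a := one_le_pow₀ (show 1 ≤ 4 + V by linarith) (n := 6)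
    have b := one_le_pow₀ (show 1 ≤ 3 + V by linarith) (n := n)
    nlinarith
  have hj1' : j ≤ N + 1 := by exact_mod_cast hj1
  have hC : (0 : ℝ) < 2 * (4 + V) ^ 2 := by positivity
  rw [e]
  set X := 2 * (4 + V) ^ 6 * (3 + V) ^ n with hX
  have hfin : 2 * (4 + V) ^ 2 * (2 * (4 + V) ^ 6) ^ 2 * 2 * ((3 + V) ^ n) ^ 2 =
      2 * (4 + V) ^ 2 * X * X * 2 := by rw [hX]; ring
  rw [hfin]
  -- Either the window stays left of the origin, or it is cut there into two pieces; the latter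
  -- gives the square of `(3 + V)^n`.
  rcases Nat.lt_or_ge N j with h | h
  · refine (mnorm_fibTransfer_neg_le hV hE (n := n) (by omega) h.le (by omega)).trans ?_
    have : 2 * (4 + V) ^ 2 * X ≤ 2 * (4 + V) ^ 2 * X * X :=
      le_mul_of_one_le_right (by positivity) hK1
    have : 0 ≤ 2 * (4 + V) ^ 2 * X * X := by positivity
    linarith
  · obtain ⟨c, rfl⟩ : ∃ c, N = j + c := ⟨N - j, by omega⟩
    have hl := mnorm_fibTransfer_neg_le hV hE (n := n) (j := j) (m := j) (by omega) le_rfl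
      (by omega)
    have hr := mnorm_fibTransfer_zero_le hV hE n c (by omega)
    have hsplit : fibTransfer V 0 E (-j) (j + c) =
        fibTransfer V 0 E 0 c * fibTransfer V 0 E (-j) j := by
      unfold fibTransfer
      rw [transfer_add, neg_add_cancel]
    rw [hsplit]
    refine (mnorm_mul_le _ _).trans
      ((mul_le_mul hr hl (mnorm_nonneg _) (by positivity)).trans ?_)
    have : 0 ≤ 2 * (4 + V) ^ 2 * X * X := by positivity
    linarith

/-! ### Mass reproduction -/

theorem IsSolution.rec {V ω E : ℝ} {u : ℤ → ℂ} (h : IsSolution V ω E u) (n : ℤ) :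
    u (n + 1) = ((E - potential V ω n : ℝ) : ℂ) * u n - u (n - 1) := by
  have := h n
  unfold diffExpr at this
  push_cast
  linear_combination this

/-- The mass of a solution is reproduced within six Fibonacci scales. -/
theorem IsSolution.mass_reproduction {V ω E : ℝ} {u : ℤ → ℂ} (h : IsSolution V ω E u)
    (hV : 0 < V) (hE : E ∈ Sigma V) {m : ℕ} (hm : 1 ≤ m) :
    (1 + 1 / ((2 + V) ^ 2 + 1)) * ∑ n ∈ Finset.Icc (1 : ℤ) (Nat.fib m), ‖u n‖ ^ 2 ≤
      ∑ n ∈ Finset.Icc (1 : ℤ) (Nat.fib (m + 6)), ‖u n‖ ^ 2 := by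
  -- Shift one is right because repetition at `j + i` also involves `j + i + 1`, and these indices
  -- run from 2 to `fib k + fib m + 1`.
  obtain ⟨k, hk1, hk2, hk⟩ := exists_cross_free ω m 1
  set l : ℤ := (Nat.fib k : ℤ) with hl
  set a : ℤ := (Nat.fib m : ℤ) with ha
  have hal : a ≤ l := Int.ofNat_le.2 (Nat.fib_mono (by omega : m ≤ k))
  have hpos : 0 ≤ a := by positivity
  -- Here `k ≤ m + 4` and `fib (m+6) = 2 fib (m+4) + fib (m+3)`, whence six levels.
  have hlarge : 2 * l + a ≤ Nat.fib (m + 6) := by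
    have h4 : Nat.fib k ≤ Nat.fib (m + 4) := Nat.fib_mono hk2
    have e2 : Nat.fib (m + 2) = Nat.fib m + Nat.fib (m + 1) := Nat.fib_add_two
    have e3 : Nat.fib (m + 3) = Nat.fib (m + 1) + Nat.fib (m + 2) := Nat.fib_add_two
    have e4 : Nat.fib (m + 4) = Nat.fib (m + 2) + Nat.fib (m + 3) := Nat.fib_add_two
    have e5 : Nat.fib (m + 5) = Nat.fib (m + 3) + Nat.fib (m + 4) := Nat.fib_add_two
    have e6 : Nat.fib (m + 6) = Nat.fib (m + 4) + Nat.fib (m + 5) := Nat.fib_add_two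
    omega
  have hrel : ∀ j ∈ Finset.Icc 1 a, ‖u j‖ ^ 2 ≤
      ((2 + V) ^ 2 + 1) * (‖u (j + l)‖ ^ 2 + ‖u (j + 2 * l)‖ ^ 2) := by
    intro j hj
    rw [Finset.mem_Icc] at hj
    have hsq := solution_square (d := fun n => E - potential V ω n) h.rec (s := j)
      (n := Nat.fib k) (fun i h0 h1 => by
        rw [show j + (Nat.fib k : ℤ) + i = j + i + Nat.fib k by ring,
          potential_congr_of_not_cross V (hk _ (by linarith) (by linarith))
            (hk _ (by linarith) (by linarith))])
    have htr : (transfer (fun n => E - potential V ω n) j (Nat.fib k)).trace = traceSeq V E k :=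
      trace_fibTransfer V ω E (by omega)
        (hk (j + 1) (by linarith) (by linarith [Int.natCast_nonneg (Nat.fib k)]))
    rw [htr] at hsq
    have h1 : ‖u j‖ ≤ (2 + V) * ‖u (j + l)‖ + ‖u (j + 2 * l)‖ := by
      rw [hsq]
      refine (norm_sub_le _ _).trans ?_
      rw [norm_mul, Complex.norm_real, Real.norm_eq_abs]
      gcongr
      exact abs_traceSeq_le hV hE k
    have h2 := norm_nonneg (u j)
    calc ‖u j‖ ^ 2 ≤ ((2 + V) * ‖u (j + l)‖ + ‖u (j + 2 * l)‖) ^ 2 := by gcongr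
      _ ≤ _ := by nlinarith [sq_nonneg ((2 + V) * ‖u (j + 2 * l)‖ - ‖u (j + l)‖)]
  have hshift : ∀ c : ℤ, ∑ j ∈ Finset.Icc 1 a, ‖u (j + c)‖ ^ 2 =
      ∑ n ∈ Finset.Icc (1 + c) (a + c), ‖u n‖ ^ 2 := by
    intro c
    rw [← Finset.map_add_right_Icc, Finset.sum_map]
    rfl
  have h1 := Finset.sum_le_sum hrel
  rw [← Finset.mul_sum, Finset.sum_add_distrib, hshift, hshift] at h1
  have h2 : ∑ n ∈ Finset.Icc 1 a, ‖u n‖ ^ 2 + (∑ n ∈ Finset.Icc (1 + l) (a + l), ‖u n‖ ^ 2 +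
      ∑ n ∈ Finset.Icc (1 + 2 * l) (a + 2 * l), ‖u n‖ ^ 2) ≤
      ∑ n ∈ Finset.Icc (1 : ℤ) (Nat.fib (m + 6)), ‖u n‖ ^ 2 := by
    rw [← Finset.sum_union, ← Finset.sum_union]
    · refine Finset.sum_le_sum_of_subset_of_nonneg (fun n hn => ?_) (fun _ _ _ => by positivity)
      simp only [Finset.mem_union, Finset.mem_Icc] at hn ⊢
      omega
    · rw [Finset.disjoint_left]
      intro n hn
      simp only [Finset.mem_union, Finset.mem_Icc] at hn ⊢
      omega
    · rw [Finset.disjoint_left]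
      intro n hn
      simp only [Finset.mem_Icc] at hn ⊢
      omega
  have hC : 0 < (2 + V) ^ 2 + 1 := by positivity
  rw [mul_comm ((2 + V) ^ 2 + 1), ← div_le_iff₀ hC] at h1
  rw [add_mul, one_mul, one_div_mul_eq_div]
  linarith

/-! ### Power laws -/

theorem phi_sq : phi ^ 2 = phi + 1 := by
  unfold phi
  have := Real.sq_sqrt (show (0 : ℝ) ≤ 5 by norm_num)
  nlinarith

theorem one_lt_phi : 1 < phi := by
  unfold phi
  have : (1 : ℝ) < Real.sqrt 5 := by rw [Real.lt_sqrt] <;> norm_num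
  linarith

theorem log_phi_pos : 0 < Real.log phi := Real.log_pos one_lt_phi

theorem phi_pow_le_fib (n : ℕ) : phi ^ n ≤ Nat.fib (n + 2) := by
  have h2 := phi_sq
  have h1 := one_lt_phi
  have key : phi ^ n ≤ Nat.fib (n + 2) ∧ phi ^ (n + 1) ≤ Nat.fib (n + 3) := by
    induction n with
    | zero => norm_num [Nat.fib]; nlinarith
    | succ n ih =>
      refine ⟨ih.2, ?_⟩
      rw [show n + 1 + 3 = n + 2 + 2 by ring, Nat.fib_add_two]
      push_cast
      calc phi ^ (n + 1 + 1) = phi ^ n * phi ^ 2 := by ring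
        _ = phi ^ n + phi ^ (n + 1) := by rw [h2]; ring
        _ ≤ _ := add_le_add ih.1 ih.2
  exact key.1

theorem fib_le_phi_pow (n : ℕ) : (Nat.fib (n + 1) : ℝ) ≤ phi ^ n := by
  have h2 := phi_sq
  have h1 := one_lt_phi
  have key : (Nat.fib (n + 1) : ℝ) ≤ phi ^ n ∧ (Nat.fib (n + 2) : ℝ) ≤ phi ^ (n + 1) := by
    induction n with
    | zero => norm_num [Nat.fib]; exact h1.le
    | succ n ih =>
      refine ⟨ih.2, ?_⟩
      rw [Nat.fib_add_two]
      push_cast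
      calc _ ≤ phi ^ n + phi ^ (n + 1) := add_le_add ih.1 ih.2
        _ = phi ^ n * phi ^ 2 := by rw [h2]; ring
        _ = _ := by ring
  exact key.1

/-- The cubic gives `a_V² ≥ 2 + V`, and `(5 + 2V)(2 + V) ≥ (3 + V)²`. -/
theorem three_add_le (V : ℝ) (hV : 0 < V) :
    3 + V ≤ Real.sqrt (5 + 2 * V) * largestRoot V := by
  obtain ⟨hroot, hmax⟩ := isGreatest_largestRoot V hV
  set a := largestRoot V
  have hroot' : a ^ 3 - (2 + V) * a - 1 = 0 := hroot
  have hpos : 0 < a := by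
    have hc : ContinuousOn (fun x : ℝ => x ^ 3 - (2 + V) * x - 1) (Set.Icc 0 (3 + V)) := by
      fun_prop
    obtain ⟨x, hx, hx0⟩ := intermediate_value_Icc (by linarith : (0 : ℝ) ≤ 3 + V) hc
      (show (0 : ℝ) ∈ _ from ⟨by norm_num, by
        nlinarith [sq_nonneg V, mul_pos hV hV, mul_pos (mul_pos hV hV) hV]⟩)
    have hxa : x ≤ a := hmax hx0
    rcases hx.1.lt_or_eq with h | h
    · linarith
    · rw [← h] at hx0; norm_num at hx0
  have ha2 : 2 + V ≤ a ^ 2 := by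
    by_contra h
    push Not at h
    nlinarith [mul_lt_mul_of_pos_left h hpos]
  have h5 := Real.sq_sqrt (show 0 ≤ 5 + 2 * V by linarith)
  have hs := Real.sqrt_nonneg (5 + 2 * V)
  refine le_of_sq_le_sq ?_ (by positivity)
  rw [mul_pow, h5]
  nlinarith

/-! ### The upper power law. -/

theorem norm_le_mnorm {V ω E : ℝ} {u : ℤ → ℂ} (h : IsSolution V ω E u)
    (h1 : ‖u 0‖ ^ 2 + ‖u 1‖ ^ 2 = 1) (N : ℕ) : ‖u N‖ ≤ mnorm (fibTransfer V ω E 0 N) := by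
  have h2 := (solution_transfer (d := fun n => E - potential V ω n) h.rec 0 N).2
  have a0 : ‖u 0‖ ≤ 1 := by nlinarith [norm_nonneg (u 0), sq_nonneg ‖u 1‖]
  have a1 : ‖u 1‖ ≤ 1 := by nlinarith [norm_nonneg (u 1), sq_nonneg ‖u 0‖]
  rw [zero_add, zero_add] at h2
  rw [h2]
  refine (norm_add_le _ _).trans ?_
  rw [norm_mul, norm_mul, Complex.norm_real, Complex.norm_real, Real.norm_eq_abs,
    Real.norm_eq_abs]
  have b0 := mul_le_of_le_one_right (abs_nonneg (fibTransfer V ω E 0 N 1 1)) a0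
  have b1 := mul_le_of_le_one_right (abs_nonneg (fibTransfer V ω E 0 N 1 0)) a1
  unfold mnorm
  have c0 := abs_nonneg (fibTransfer V ω E 0 N 0 0)
  have c1 := abs_nonneg (fibTransfer V ω E 0 N 0 1)
  change |fibTransfer V ω E 0 N 1 0| * _ + |fibTransfer V ω E 0 N 1 1| * _ ≤ _
  linarith

theorem localNorm_le {u : ℤ → ℂ} {L B : ℝ} (hL : 1 ≤ L) (hB : 0 ≤ B)
    (h : ∀ N : ℕ, (N : ℝ) ≤ L + 1 → ‖u N‖ ≤ B) : localNorm u L ≤ Real.sqrt (2 * L) * B := by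
  unfold localNorm
  obtain ⟨M, hM⟩ := Int.eq_ofNat_of_zero_le (Int.floor_nonneg.2 (show 0 ≤ L by linarith))
  have hfl := Int.floor_le L
  have hlt := Int.lt_floor_add_one L
  rw [hM] at hfl hlt ⊢
  push_cast at hfl hlt
  refine (Real.sqrt_le_sqrt (y := 2 * L * B ^ 2) ?_).trans_eq ?_
  · have h1 : ∑ n ∈ Finset.Icc (1 : ℤ) M, ‖u n‖ ^ 2 ≤ M * B ^ 2 := by
      calc _ ≤ ∑ n ∈ Finset.Icc (1 : ℤ) M, B ^ 2 := by
            refine Finset.sum_le_sum fun n hn => ?_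
            rw [Finset.mem_Icc] at hn
            obtain ⟨n, rfl⟩ := Int.eq_ofNat_of_zero_le (show 0 ≤ n by linarith)
            have : (n : ℝ) ≤ M := by exact_mod_cast hn.2
            have := h n (by linarith)
            gcongr
        _ = _ := by simp
    have h2 := h (M + 1) (by push_cast; linarith)
    push_cast at h2
    have h3 : ‖u (M + 1)‖ ^ 2 ≤ B ^ 2 := by gcongr
    have h4 : (L - (M : ℤ)) * ‖u (M + 1)‖ ^ 2 ≤ (L - M) * B ^ 2 := by
      push_cast
      exact mul_le_mul_of_nonneg_left h3 (by linarith)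
    push_cast at h4 ⊢
    nlinarith [sq_nonneg B]
  · rw [Real.sqrt_mul (by positivity), Real.sqrt_sq hB]

theorem upper_bound {V : ℝ} (hV : 0 < V) {γ : ℝ}
    (hγ : 1 + Real.log (Real.sqrt (5 + 2 * V) * (3 + V) * largestRoot V) / Real.log phi < γ) :
    ∃ C : ℝ, 0 < C ∧ ∀ (ω E : ℝ) (u : ℤ → ℂ), E ∈ Sigma V → IsSolution V ω E u →
      ‖u 0‖ ^ 2 + ‖u 1‖ ^ 2 = 1 → ∀ L : ℝ, 1 ≤ L → localNorm u L ≤ C * L ^ γ := by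
  obtain ⟨D, hD, hbound⟩ := exists_mnorm_fibTransfer_le hV
  have hphi := one_lt_phi
  have hphi0 : 0 < phi := by linarith
  have hlog := log_phi_pos
  have hlam : (1 : ℝ) < 3 + V := by linarith
  set β := 2 * Real.log (3 + V) / Real.log phi with hβ
  have hβ0 : 0 ≤ β := div_nonneg (mul_nonneg (by norm_num) (Real.log_nonneg hlam.le)) hlog.le
  have hexp : 1 / 2 + β ≤ γ := by
    have h1 : (3 + V) ^ 2 ≤ Real.sqrt (5 + 2 * V) * (3 + V) * largestRoot V := by
      have := three_add_le V hV
      nlinarith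
    have h2 := Real.log_le_log (by positivity) h1
    rw [Real.log_pow] at h2
    have h3 : β ≤ Real.log (Real.sqrt (5 + 2 * V) * (3 + V) * largestRoot V) / Real.log phi := by
      rw [hβ]
      gcongr
      exact_mod_cast h2
    linarith
  have hpow : ∀ n : ℕ, ((3 + V) ^ n) ^ 2 = (phi ^ n) ^ β := by
    intro n
    have h1 : phi ^ β = (3 + V) ^ 2 := by
      rw [Real.rpow_def_of_pos hphi0, hβ, mul_div_cancel₀ _ hlog.ne', two_mul, Real.exp_add,
        Real.exp_log (by linarith), sq]
    rw [← Real.rpow_natCast phi n, ← Real.rpow_mul hphi0.le, mul_comm (n : ℝ), Real.rpow_mul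
      hphi0.le, h1, Real.rpow_natCast, ← pow_mul, ← pow_mul, mul_comm]
  refine ⟨Real.sqrt 2 * (D * (phi ^ 3 * 4) ^ β), by positivity, ?_⟩
  intro ω E u hE hu h1 L hL
  -- With `L + 3` in place of `L`, every `N ≤ L + 1` satisfies `N + 2 ≤ fib (n + 3)`; `L + 3 ≤ 4L`
  -- produces the constant `φ³ · 4`.
  obtain ⟨n, hn1, hn2⟩ := exists_nat_pow_near (show 1 ≤ L + 3 by linarith) hphi
  have hfib : (L + 3 : ℝ) ≤ Nat.fib (n + 3) := hn2.le.trans (phi_pow_le_fib (n + 1))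
  have hB : ∀ N : ℕ, (N : ℝ) ≤ L + 1 → ‖u N‖ ≤ D * ((phi ^ 3 * 4) * L) ^ β := by
    intro N hN
    have hN' : N + 2 ≤ Nat.fib (n + 3) := by
      have : ((N + 2 : ℕ) : ℝ) ≤ Nat.fib (n + 3) := by push_cast; linarith
      exact_mod_cast this
    refine (norm_le_mnorm hu h1 N).trans ((hbound ω E hE (n + 3) N hN').trans ?_)
    rw [hpow]
    gcongr
    rw [pow_add, mul_comm, mul_assoc]
    gcongr
    linarith
  refine (localNorm_le hL (by positivity) hB).trans ?_
  have hL0 : 0 < L := by linarith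
  rw [Real.mul_rpow (by positivity) hL0.le, Real.sqrt_mul (by norm_num), Real.sqrt_eq_rpow L]
  calc _ = Real.sqrt 2 * (D * (phi ^ 3 * 4) ^ β) * (L ^ (1 / 2 : ℝ) * L ^ β) := by ring
    _ = Real.sqrt 2 * (D * (phi ^ 3 * 4) ^ β) * L ^ (1 / 2 + β) := by rw [Real.rpow_add hL0]
    _ ≤ _ := by
      gcongr

/-! ### The lower power law. -/

theorem initial_mass {V ω E : ℝ} {u : ℤ → ℂ} (hV : 0 < V) (hE : E ∈ Sigma V)
    (h : IsSolution V ω E u) (h1 : ‖u 0‖ ^ 2 + ‖u 1‖ ^ 2 = 1) :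
    1 / (2 + 2 * (2 + V) ^ 2) ≤ ‖u 1‖ ^ 2 + ‖u 2‖ ^ 2 := by
  have hr := h.rec 1
  norm_num at hr
  have h0 : ‖u 0‖ ≤ (2 + V) * ‖u 1‖ + ‖u 2‖ := by
    have e : u 0 = ((E - potential V ω 1 : ℝ) : ℂ) * u 1 - u 2 := by
      push_cast; linear_combination hr
    rw [e]
    refine (norm_sub_le _ _).trans ?_
    rw [norm_mul, Complex.norm_real, Real.norm_eq_abs]
    gcongr
    exact abs_sub_potential_le hV hE ω 1
  have h3 : ‖u 0‖ ^ 2 ≤ ((2 + V) * ‖u 1‖ + ‖u 2‖) ^ 2 := by gcongr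
  rw [div_le_iff₀ (by positivity)]
  nlinarith [sq_nonneg ((2 + V) * ‖u 1‖ - ‖u 2‖), sq_nonneg ‖u 1‖, sq_nonneg ‖u 2‖,
    mul_nonneg (sq_nonneg (2 + V)) (sq_nonneg ‖u 2‖)]

theorem sum_le_localNorm_sq (u : ℤ → ℂ) {L : ℝ} {N : ℕ} (hN : (N : ℝ) ≤ L) :
    ∑ n ∈ Finset.Icc (1 : ℤ) N, ‖u n‖ ^ 2 ≤ localNorm u L ^ 2 := by
  have h1 : ((N : ℤ)) ≤ ⌊L⌋ := Int.le_floor.2 (by exact_mod_cast hN)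
  have h2 : 0 ≤ (L - ⌊L⌋) * ‖u (⌊L⌋ + 1)‖ ^ 2 :=
    mul_nonneg (sub_nonneg.2 (Int.floor_le L)) (by positivity)
  have h3 : ∑ n ∈ Finset.Icc (1 : ℤ) N, ‖u n‖ ^ 2 ≤ ∑ n ∈ Finset.Icc (1 : ℤ) ⌊L⌋, ‖u n‖ ^ 2 :=
    Finset.sum_le_sum_of_subset_of_nonneg (Finset.Icc_subset_Icc le_rfl h1)
      (fun _ _ _ => by positivity)
  have h4 : 0 ≤ ∑ n ∈ Finset.Icc (1 : ℤ) ⌊L⌋, ‖u n‖ ^ 2 :=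
    Finset.sum_nonneg fun _ _ => by positivity
  unfold localNorm
  rw [Real.sq_sqrt (by linarith)]
  linarith

/-- For `L < 2` the site 2 enters only with weight `L - 1`. This is where `L₀ > 1` matters: at `L =
1` the norm vanishes if `u(1) = 0`. -/
theorem min_mul_le_localNorm_sq (u : ℤ → ℂ) {L₀ L : ℝ} (h0 : 1 < L₀) (hL : L₀ ≤ L) :
    min 1 (L₀ - 1) * (‖u 1‖ ^ 2 + ‖u 2‖ ^ 2) ≤ localNorm u L ^ 2 := by
  have a1 := sq_nonneg ‖u 1‖
  have a2 := sq_nonneg ‖u 2‖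
  have m1 := min_le_left 1 (L₀ - 1)
  have m2 := min_le_right 1 (L₀ - 1)
  rcases lt_or_ge L 2 with h | h
  · have hf : ⌊L⌋ = 1 := by rw [Int.floor_eq_iff]; constructor <;> push_cast <;> linarith
    unfold localNorm
    rw [hf]
    norm_num
    rw [Real.sq_sqrt (by nlinarith)]
    nlinarith
  · have := sum_le_localNorm_sq u (L := L) (N := 2) (by exact_mod_cast h)
    have e : ∑ n ∈ Finset.Icc (1 : ℤ) (2 : ℕ), ‖u n‖ ^ 2 = ‖u 1‖ ^ 2 + ‖u 2‖ ^ 2 := by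
      rw [show Finset.Icc (1 : ℤ) (2 : ℕ) = {1, 2} by decide]
      simp
    rw [e] at this
    nlinarith

/-- Converts the exponent obtained, with denominator 12, into the stated one with 16: `4y ≤ 5z` and
`(1 + y)³ ≤ (1 + 4y/5)⁴`. -/
theorem three_mul_log_le {V : ℝ} (hV : 0 < V) :
    3 * Real.log (1 + 1 / (2 + 2 * V) ^ 2) ≤ 4 * Real.log (1 + 1 / ((2 + V) ^ 2 + 1)) := by
  set y := 1 / (2 + 2 * V) ^ 2 with hy
  set z := 1 / ((2 + V) ^ 2 + 1) with hz
  have hy0 : 0 < y := by positivity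
  have hz0 : 0 < z := by positivity
  have h1 : 4 * y ≤ 5 * z := by
    rw [hy, hz, mul_one_div, mul_one_div, div_le_div_iff₀ (by positivity) (by positivity)]
    nlinarith
  have h2 : (1 + y) ^ 3 ≤ (1 + z) ^ 4 := by
    have h3 : 1 + 4 / 5 * y ≤ 1 + z := by linarith
    calc (1 + y) ^ 3 ≤ (1 + 4 / 5 * y) ^ 4 := by
          nlinarith [mul_pos hy0 hy0, mul_pos (mul_pos hy0 hy0) hy0,
            mul_pos (mul_pos hy0 hy0) (mul_pos hy0 hy0)]
      _ ≤ _ := by gcongr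
  have h4 := Real.log_le_log (by positivity) h2
  rw [Real.log_pow, Real.log_pow] at h4
  exact_mod_cast h4

theorem lower_bound {V : ℝ} (hV : 0 < V) {γ : ℝ}
    (hγ : γ < Real.log (1 + 1 / (2 + 2 * V) ^ 2) / (16 * Real.log phi)) {L₀ : ℝ} (hL₀ : 1 < L₀) :
    ∃ C : ℝ, 0 < C ∧ ∀ (ω E : ℝ) (u : ℤ → ℂ), E ∈ Sigma V → IsSolution V ω E u →
      ‖u 0‖ ^ 2 + ‖u 1‖ ^ 2 = 1 → ∀ L : ℝ, L₀ ≤ L → C * L ^ γ ≤ localNorm u L := by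
  have hphi := one_lt_phi
  have hphi0 : 0 < phi := by linarith
  have hlog := log_phi_pos
  set κ := 1 + 1 / ((2 + V) ^ 2 + 1) with hκ
  have hκ1 : 1 < κ := by
    have : 0 < 1 / ((2 + V) ^ 2 + 1) := by positivity
    linarith
  have hκ0 : 0 < κ := by linarith
  -- Mass gains `κ` per factor `φ^6` in length, and the norm is its square root, hence 12.
  set γ' := Real.log κ / (12 * Real.log phi) with hγ'
  have hγγ : γ ≤ γ' := by
    refine hγ.le.trans ?_
    rw [hγ', div_le_div_iff₀ (by positivity) (by positivity)]
    nlinarith [three_mul_log_le hV]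
  set θ := min 1 (L₀ - 1) with hθ
  have hθ0 : 0 < θ := lt_min one_pos (by linarith)
  set c := θ * (1 / (2 + 2 * (2 + V) ^ 2)) with hc
  have hc0 : 0 < c := by positivity
  -- Pays for rounding: `r + 1 > (x - 2)/6` means `r > x/6 - 4/3`.
  set b := Real.exp (-(4 / 3) * Real.log κ) with hb
  refine ⟨Real.sqrt (c * b), by positivity, ?_⟩
  intro ω E u hE hu h1 L hL
  have hL1 : 1 < L := by linarith
  have hL0 : 0 < L := by linarith
  have hmass := initial_mass hV hE hu h1
  have key : ∀ r : ℕ, κ ^ r * (1 / (2 + 2 * (2 + V) ^ 2)) ≤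
      ∑ n ∈ Finset.Icc (1 : ℤ) (Nat.fib (6 * r + 3)), ‖u n‖ ^ 2 := by
    intro r
    induction r with
    | zero =>
      have e : Finset.Icc (1 : ℤ) (Nat.fib (6 * 0 + 3)) = {1, 2} := by decide
      rw [e]
      simpa using hmass
    | succ r ih =>
      have := hu.mass_reproduction hV hE (m := 6 * r + 3) (by omega)
      rw [show 6 * (r + 1) + 3 = 6 * r + 3 + 6 by ring]
      refine le_trans ?_ this
      rw [pow_succ', mul_assoc]
      exact mul_le_mul_of_nonneg_left ih hκ0.le
  set x := Real.log L / Real.log phi with hx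
  set r := ⌊(x - 2) / 6⌋₊ with hr
  have hlt : (x - 2) / 6 < r + 1 := Nat.lt_floor_add_one _
  have hpow : κ ^ r * c ≤ localNorm u L ^ 2 := by
    -- For `r = 0` the starting block `[1, fib 3] = {1, 2}` may stick out beyond `L`; the factor `θ`
    -- covers this.
    rcases Nat.eq_zero_or_pos r with h0 | h0
    · rw [h0, pow_zero, one_mul]
      refine le_trans ?_ (min_mul_le_localNorm_sq u hL₀ hL)
      exact mul_le_mul_of_nonneg_left hmass hθ0.le
    · have hle : (r : ℝ) ≤ (x - 2) / 6 := by
        refine Nat.floor_le ?_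
        by_contra hneg
        push Not at hneg
        have : r = 0 := Nat.floor_of_nonpos hneg.le
        omega
      have hfib : (Nat.fib (6 * r + 3) : ℝ) ≤ L := by
        refine (fib_le_phi_pow (6 * r + 2)).trans ?_
        rw [← Real.log_le_log_iff (by positivity) hL0, Real.log_pow]
        have : ((6 * r + 2 : ℕ) : ℝ) ≤ x := by push_cast; linarith
        rwa [hx, le_div_iff₀ hlog] at this
      refine le_trans ?_ (sum_le_localNorm_sq u hfib)
      refine le_trans ?_ (key r)
      refine mul_le_mul_of_nonneg_left ?_ (by positivity)
      exact mul_le_of_le_one_left (by positivity) (min_le_left _ _)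
  have hLγ : (L ^ γ) ^ 2 ≤ (L ^ γ') ^ 2 := by
    gcongr
    exact hL1.le
  have hLκ : b * (L ^ γ') ^ 2 ≤ κ ^ r := by
    rw [← Real.log_le_log_iff (by positivity) (by positivity), Real.log_mul (by positivity)
      (by positivity), Real.log_pow, Real.log_pow, Real.log_rpow hL0, hb, Real.log_exp]
    have hlκ : 0 < Real.log κ := Real.log_pos hκ1
    have e : γ' * Real.log L = Real.log κ * x / 12 := by
      rw [hγ', hx]; field_simp
    rw [e]
    push_cast
    nlinarith
  refine le_of_sq_le_sq ?_ (Real.sqrt_nonneg _)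
  rw [mul_pow, Real.sq_sqrt (by positivity)]
  calc c * b * (L ^ γ) ^ 2 ≤ c * b * (L ^ γ') ^ 2 := by gcongr
    _ = c * (b * (L ^ γ') ^ 2) := by ring
    _ ≤ c * κ ^ r := by gcongr
    _ ≤ _ := by rw [mul_comm]; exact hpow

end FibHam

theorem theoremt (V : ℝ) (hV : 0 < V) (γl γu : ℝ)
    (hl : γl < Real.log (1 + 1 / (2 + 2 * V) ^ 2) / (16 * Real.log FibHam.phi))
    (hu : γu > 1 + Real.log (Real.sqrt (5 + 2 * V) * (3 + V) * FibHam.largestRoot V)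
      / Real.log FibHam.phi) :
    (∃ Cu : ℝ, 0 < Cu ∧ ∀ (ω E : ℝ) (u : ℤ → ℂ), E ∈ FibHam.Sigma V →
      FibHam.IsSolution V ω E u → ‖u 0‖ ^ 2 + ‖u 1‖ ^ 2 = 1 →
      ∀ L : ℝ, 1 ≤ L → FibHam.localNorm u L ≤ Cu * L ^ γu) ∧
    (∀ L₀ : ℝ, 1 < L₀ →
      ∃ Cl : ℝ, 0 < Cl ∧ ∀ (ω E : ℝ) (u : ℤ → ℂ), E ∈ FibHam.Sigma V →
        FibHam.IsSolution V ω E u → ‖u 0‖ ^ 2 + ‖u 1‖ ^ 2 = 1 →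
        ∀ L : ℝ, L₀ ≤ L → Cl * L ^ γl ≤ FibHam.localNorm u L) :=
  ⟨FibHam.upper_bound hV hu, fun _ hL₀ => FibHam.lower_bound hV hl hL₀⟩
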